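/- **Setting.** Let $\omega\in(0,2\pi)$, $\zeta>0$, and use polar coordinates $(r,\theta)$ with $\theta\in\mathbb{R}/2\pi\mathbb{Z}$. Put $\mathcal S_-=\{|\theta|<\omega/2\}$ (conductor) and $\mathcal S_+=\{\omega/2<\theta<2\pi-\omega/2\}$. An angular function is a $C^1$ function $\mathbb{R}/2\pi\mathbb{Z}\to\mathbb{C}$ which is $C^\infty$ on each of the two closed arcs $|\theta|\le\omega/2$ and $\omega/2\le\theta\le 2\pi-\omega/2$. *Primal singular functions.* For every $(k,p)\in\mathbb{N}\times\{0,1\}$ with $(k,p)\neq(0,1)$ fix a formal series $\mathfrak S^{k,p}=\sum_{j\ge0}(i\zeta^2)^j\mathfrak s^{k,p}_j$, $$\mathfrak s_j^{k,p}(r,\theta)=r^{k+2j}\sum_{n=0}^{j}\log^n r\;\Phi^{k,p}_{j,n}(\theta),\qquad \mathfrak s^{k,p}_0=r^k\cos(k\theta-p\pi/2),$$ with angular functions $\Phi^{k,p}_{j,n}$, such that for $j\ge1$ one has $\Delta\mathfrak s^{k,p}_j=0$ in $\mathcal S_+$ and $\Delta\mathfrak s^{k,p}_j=4\mathfrak s^{k,p}_{j-1}$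 in $\mathcal S_-$, and all $\mathfrak s_j^{k,p}$ are even in $\theta$ if $p=0$ and odd if $p=1$. Put $\Phi^{k,p}_{j,n}=0$ for $n>j$ and, by convention, $\Phi^{0,1}_{j,n}=0$ for all $j,n$ (that is, $\mathfrak S^{0,1}=0$). *Dual singular functions.* For $k\ge 2$ and $p\in\{0,1\}$ fix likewise $\mathfrak K^{k,p}=\sum_{j\ge0}(i\zeta^2)^j\mathfrak k_j^{k,p}$, $$\mathfrak k_j^{k,p}(r,\theta)=r^{-k+2j}\sum_{n=0}^{d_j}\log^n r\;\Psi^{k,p}_{j,n}(\theta),\qquad \mathfrak k_0^{k,p}=\frac{1}{2k\pi}r^{-k}\cos(k\theta-p\pi/2),$$ where $d_j=j$ if $k$ is odd or $j<k/2$ and $d_j=j+1$ otherwise, with angular functions $\Psi^{k,p}_{j,n}$, the same shadow equations ($\Delta\mathfrak k_j=0$ in $\mathcal S_+$, $\Delta\mathfrak k_j=4\mathfrak k_{j-1}$ in $\mathcal S_-$ for $j\ge1$) and the same parity. Put $\Psi^{k,p}_{j,n}=0$ for $n>d_j$. *Coupling coefficients.* Let $\mathfrak S^{k,p}_m$, $\mathfrak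 K^{k,p}_m$ be the sums of the terms $j\le m$ of these series, let $\mathcal J_R(K,A)=\int_0^{2\pi}(K\partial_rA-A\partial_rK)|_{r=R}\,R\,d\theta$ and $R_0=\zeta R(1+\sqrt{|\log R|})$. A function $A$, $C^1$ near $r=0$ for $r>0$, has *corner expansion* $A\sim\sum_{k,p}\Lambda^{k,p}\mathfrak S^{k,p}$ with singular coefficients $\Lambda^{k,p}\in\mathbb{C}$ if for every $N$ the difference $D_N$ between $A$ and the sum of all terms $\Lambda^{k,p}(i\zeta^2)^j\mathfrak s_j^{k,p}$ with $k+2j\le N$ satisfies $D_N=o(r^N)$ and $r\partial_rD_N=o(r^N)$ as $r\to0$, uniformly in $\theta$. (Since $\mathfrak S^{0,1}=0$, the number $\Lambda^{0,1}$ is arbitrary.) For given $k\ge2$, $p\in\{0,1\}$ and $m$ with $2m+2>k$, numbers $\mathcal J^{k,p;k-2\ell,p}$, $1\le\ell\le[k/2]$, are called *coupling coefficients* if for every $A$ with a corner expansion $$\mathcal J_R(\mathfrak K^{k,p}_m,A)=\Lambda^{k,p}+\sum_{\ell=1}^{[k/2]}\mathcal J^{k,p;k-2\ell,p}\,\Lambda^{k-2\ell,p}+O\big(R^{-k}R_0^{2m+2}\log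 R\big)\qquad(R\to0).$$ **Proposition.** Let $k\ge2$, $p\in\{0,1\}$ and $2m+2>k$. The coupling coefficients exist, are unique, do not depend on $m$, and for $1\le\ell\le[k/2]$ are given by $$\mathcal J^{k,p;k-2\ell,p}=(i\zeta^2)^\ell\sum_{j=0}^{\ell}\int_0^{2\pi}\Psi^{k,p}_{j,0}(\theta)\Big[2(k-2j)\Phi^{k-2\ell,p}_{\ell-j,0}(\theta)+\Phi^{k-2\ell,p}_{\ell-j,1}(\theta)\Big]-\Psi^{k,p}_{j,1}(\theta)\,\Phi^{k-2\ell,p}_{\ell-j,0}(\theta)\,d\theta .$$ Moreover, $\mathcal J^{k,p;k-2\ell,p}=\lim_{R\to0}\mathcal J_R(\mathfrak K^{k,p}_m,\mathfrak S^{k-2\ell,p}_{m'})$ for all $m'\ge m$ and $1\le\ell\le[k/2]$. -/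

import Mathlib

open Filter Topology

noncomputable section

/-- Admissible angular functions for the opening `ω` of the conductor: `C¹` functions on the circle
`ℝ / 2πℤ` (as `2π`-periodic functions on `ℝ`) which are `C^∞` on each of the two closed arcs
`|θ| ≤ ω/2` (conductor) and `ω/2 ≤ θ ≤ 2π - ω/2` (exterior). -/
structure IsAngular (ω : ℝ) (Φ : ℝ → ℂ) : Prop where
  periodic : Function.Periodic Φ (2 * Real.pi)
  contDiff_one : ContDiff ℝ 1 Φ
  smooth_minus : ContDiffOn ℝ ((⊤ : ℕ∞) : WithTop ℕ∞) Φ (Set.Icc (-(ω / 2)) (ω / 2))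
  smooth_plus :
    ContDiffOn ℝ ((⊤ : ℕ∞) : WithTop ℕ∞) Φ (Set.Icc (ω / 2) (2 * Real.pi - ω / 2))

/-- The operator `r ∂_r` on functions given in polar coordinates `(r, θ)`. -/
def rDeriv (u : ℝ → ℝ → ℂ) (r θ : ℝ) : ℂ := (r : ℂ) * deriv (fun ρ => u ρ θ) r

/-- The Laplacian in polar coordinates, `Δ u = r⁻² ((r ∂_r)² u + ∂_θ² u)`. -/
def polarLaplacian (u : ℝ → ℝ → ℂ) (r θ : ℝ) : ℂ :=
  ((r : ℂ) ^ 2)⁻¹ *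
    (rDeriv (rDeriv u) r θ + deriv (fun t => deriv (fun t' => u r t') t) θ)

/-- The quasi-homogeneous function `r ^ a * ∑_{n ≤ d} (log r) ^ n * Φ_n(θ)`. -/
def quasiHom (a : ℤ) (d : ℕ) (Φ : ℕ → ℝ → ℂ) (r θ : ℝ) : ℂ :=
  (r : ℂ) ^ a * ∑ n ∈ Finset.range (d + 1), ((Real.log r : ℝ) : ℂ) ^ n * Φ n θ

/-- The sequence `u 0, u 1, …` solves the shadow problems
`Δ u_{j+1} = 0` in the exterior sector and `Δ u_{j+1} = 4 u_j` in the conductor sector. -/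
def IsShadowSequence (ω : ℝ) (u : ℕ → ℝ → ℝ → ℂ) : Prop :=
  (∀ j : ℕ, ∀ r : ℝ, 0 < r → ∀ θ ∈ Set.Ioo (ω / 2) (2 * Real.pi - ω / 2),
      polarLaplacian (u (j + 1)) r θ = 0) ∧
  (∀ j : ℕ, ∀ r : ℝ, 0 < r → ∀ θ ∈ Set.Ioo (-(ω / 2)) (ω / 2),
      polarLaplacian (u (j + 1)) r θ = 4 * u j r θ)

/-- The harmonic polynomial `r ^ k cos (k θ - p π / 2)`.
For `(k, p) = (0, 0)` it is `1`, and for `(k, p) = (0, 1)` it is `0`. -/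
def primalLeading (k : ℕ) (p : Fin 2) (r θ : ℝ) : ℂ :=
  ((r ^ k * Real.cos (k * θ - ((p : ℕ) : ℝ) * Real.pi / 2) : ℝ) : ℂ)

/-- The dual harmonic function `-(1 / 2π) log r` if `k = 0`, and
`(1 / 2kπ) r ^ (-k) cos (k θ - p π / 2)` if `k ≥ 1`. -/
def dualLeading (k : ℕ) (p : Fin 2) (r θ : ℝ) : ℂ :=
  if k = 0 then ((-(1 / (2 * Real.pi)) * Real.log r : ℝ) : ℂ)
  else ((1 / (2 * k * Real.pi) * r ^ (-(k : ℤ)) *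
    Real.cos (k * θ - ((p : ℕ) : ℝ) * Real.pi / 2) : ℝ) : ℂ)

/-- The term `𝔰_j(r, θ) = r ^ (k + 2j) ∑_{n ≤ j} (log r) ^ n Φ_{j,n}(θ)`. -/
def primalTerm (k : ℕ) (Φ : ℕ → ℕ → ℝ → ℂ) (j : ℕ) (r θ : ℝ) : ℂ :=
  quasiHom ((k : ℤ) + 2 * j) j (Φ j) r θ

/-- The degree in `log r` allowed for the `j`-th dual term: `j` if `k` is odd or `j < k / 2`,
and `j + 1` otherwise. -/
def dualDegree (k j : ℕ) : ℕ := if Odd k ∨ 2 * j < k then j else j + 1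

/-- The term `𝔨_j(r, θ) = r ^ (-k + 2j) ∑_{n ≤ dualDegree k j} (log r) ^ n Ψ_{j,n}(θ)`. -/
def dualTerm (k : ℕ) (Ψ : ℕ → ℕ → ℝ → ℂ) (j : ℕ) (r θ : ℝ) : ℂ :=
  quasiHom (-(k : ℤ) + 2 * j) (dualDegree k j) (Ψ j) r θ

/-- `Φ_{j,n}` are the angular coefficients of a primal singular function `𝔖^{k,p}`: a leading
harmonic polynomial and its shadows, even in `θ` if `p = 0` and odd if `p = 1`, with the convention
`Φ_{j,n} = 0` for `n > j`. For `(k, p) = (0, 1)`, where there is no singular function, the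
coefficients are `0` by convention. The transmission conditions are part of `IsAngular`. -/
structure IsPrimalSingularity (ω : ℝ) (k : ℕ) (p : Fin 2) (Φ : ℕ → ℕ → ℝ → ℂ) : Prop where
  angular : ∀ j n, IsAngular ω (Φ j n)
  eq_zero_of_lt : ∀ j n, j < n → Φ j n = 0
  leading : ∀ r : ℝ, 0 < r → ∀ θ, primalTerm k Φ 0 r θ = primalLeading k p r θ
  shadow : IsShadowSequence ω (primalTerm k Φ)
  parity : ∀ j, ∀ r : ℝ, 0 < r → ∀ θ,
    primalTerm k Φ j r (-θ) = (-1) ^ (p : ℕ) * primalTerm k Φ j r θ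
  convention : k = 0 → p = 1 → ∀ j n, Φ j n = 0

/-- `Ψ_{j,n}` are the angular coefficients of a dual singular function `𝔎^{k,p}`. -/
structure IsDualSingularity (ω : ℝ) (k : ℕ) (p : Fin 2) (Ψ : ℕ → ℕ → ℝ → ℂ) : Prop where
  angular : ∀ j n, IsAngular ω (Ψ j n)
  eq_zero_of_lt : ∀ j n, dualDegree k j < n → Ψ j n = 0
  leading : ∀ r : ℝ, 0 < r → ∀ θ, dualTerm k Ψ 0 r θ = dualLeading k p r θ
  shadow : IsShadowSequence ω (dualTerm k Ψ)
  parity : ∀ j, ∀ r : ℝ, 0 < r → ∀ θ,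
    dualTerm k Ψ j r (-θ) = (-1) ^ (p : ℕ) * dualTerm k Ψ j r θ

/-- Truncated primal series `𝔖_m = ∑_{j ≤ m} (i ζ²) ^ j 𝔰_j`. -/
def primalTrunc (ζ : ℝ) (k : ℕ) (Φ : ℕ → ℕ → ℝ → ℂ) (m : ℕ) (r θ : ℝ) : ℂ :=
  ∑ j ∈ Finset.range (m + 1), (Complex.I * (ζ : ℂ) ^ 2) ^ j * primalTerm k Φ j r θ

/-- Quasi-dual function `𝔎_m = ∑_{j ≤ m} (i ζ²) ^ j 𝔨_j` of order `m`. -/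
def dualTrunc (ζ : ℝ) (k : ℕ) (Ψ : ℕ → ℕ → ℝ → ℂ) (m : ℕ) (r θ : ℝ) : ℂ :=
  ∑ j ∈ Finset.range (m + 1), (Complex.I * (ζ : ℂ) ^ 2) ^ j * dualTerm k Ψ j r θ

/-- The anti-symmetric form `𝒥_R(K, A) = ∫_{r = R} (K ∂_r A - A ∂_r K) R dθ`. -/
def dualForm (R : ℝ) (K A : ℝ → ℝ → ℂ) : ℂ :=
  ∫ θ in (0 : ℝ)..(2 * Real.pi),
    (K R θ * deriv (fun r => A r θ) R - A R θ * deriv (fun r => K r θ) R) * (R : ℂ)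

/-- The part of homogeneity at most `N` of the formal series `∑_{k,p} Λ^{k,p} 𝔖^{k,p}`. -/
def cornerPartialSum (ζ : ℝ) (Φ : ℕ → Fin 2 → ℕ → ℕ → ℝ → ℂ) (Λ : ℕ → Fin 2 → ℂ)
    (N : ℕ) (r θ : ℝ) : ℂ :=
  ∑ k ∈ Finset.range (N + 1), ∑ p : Fin 2,
    Λ k p * primalTrunc ζ k (Φ k p) ((N - k) / 2) r θ

/-- `A` (in polar coordinates, `C¹` in a punctured neighborhood of the corner) has the corner
asymptotics `A ∼ ∑_{k,p} Λ^{k,p} 𝔖^{k,p}` as `r → 0`, with singular coefficients `Λ^{k,p}`.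
The expansion is uniform in `θ` and can be differentiated once in `r`. -/
structure HasCornerExpansion (ζ : ℝ) (Φ : ℕ → Fin 2 → ℕ → ℕ → ℝ → ℂ)
    (A : ℝ → ℝ → ℂ) (Λ : ℕ → Fin 2 → ℂ) : Prop where
  periodic : ∀ r : ℝ, Function.Periodic (A r) (2 * Real.pi)
  regular : ∃ R₁ : ℝ, 0 < R₁ ∧
    ContDiffOn ℝ 1 (fun x : ℝ × ℝ => A x.1 x.2) (Set.Ioo 0 R₁ ×ˢ Set.univ)
  expansion : ∀ N : ℕ, ∀ ε : ℝ, 0 < ε → ∀ᶠ r in 𝓝[>] (0 : ℝ), ∀ θ : ℝ,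
    ‖A r θ - cornerPartialSum ζ Φ Λ N r θ‖ ≤ ε * r ^ N ∧
    ‖rDeriv (fun ρ t => A ρ t - cornerPartialSum ζ Φ Λ N ρ t) r θ‖ ≤ ε * r ^ N

/-- `R₀ = ζ R (1 + √|log R|)`. -/
def cornerScale (ζ R : ℝ) : ℝ := ζ * R * (1 + Real.sqrt |Real.log R|)

/-- The numbers `c 1, …, c [k/2]` are coupling coefficients `𝒥^{k,p; k-2ℓ,p}`, `ℓ = 1, …, [k/2]`,
for the extraction by the quasi-dual function `𝔎^{k,p}_m`: for every `A` with singular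
coefficients `Λ`,
`𝒥_R(𝔎_m, A) = Λ^{k,p} + ∑_ℓ c_ℓ Λ^{k-2ℓ,p} + O(R ^ (-k) R₀ ^ (2m+2) log R)` as `R → 0`. -/
def IsCouplingFamily (ζ : ℝ) (Φ : ℕ → Fin 2 → ℕ → ℕ → ℝ → ℂ) (k : ℕ) (p : Fin 2)
    (Ψ : ℕ → ℕ → ℝ → ℂ) (m : ℕ) (c : ℕ → ℂ) : Prop :=
  ∀ (A : ℝ → ℝ → ℂ) (Λ : ℕ → Fin 2 → ℂ), HasCornerExpansion ζ Φ A Λ →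
    (fun R : ℝ => dualForm R (dualTrunc ζ k Ψ m) A -
        (Λ k p + ∑ l ∈ Finset.Icc 1 (k / 2), c l * Λ (k - 2 * l) p))
      =O[𝓝[>] (0 : ℝ)]
    (fun R : ℝ => R ^ (-(k : ℤ)) * cornerScale ζ R ^ (2 * m + 2) * Real.log R)

/-- The angular formula for the coupling coefficient `𝒥^{k,p; k-2ℓ,p}`; here `Φ` are the angular
coefficients of `𝔖^{k-2ℓ,p}` and `Ψ` those of `𝔎^{k,p}`. -/
def angularCoupling (ζ : ℝ) (k l : ℕ) (Φ Ψ : ℕ → ℕ → ℝ → ℂ) : ℂ :=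
  (Complex.I * (ζ : ℂ) ^ 2) ^ l *
    ∑ j ∈ Finset.range (l + 1), ∫ θ in (0 : ℝ)..(2 * Real.pi),
      (Ψ j 0 θ * (2 * ((k : ℂ) - 2 * (j : ℂ)) * Φ (l - j) 0 θ + Φ (l - j) 1 θ)
        - Ψ j 1 θ * Φ (l - j) 0 θ)

end

noncomputable section

/-- The action of `r ∂_r` on the angular coefficients of a quasi-homogeneous function of
degree `a`. -/
def eulerCoeff (a : ℤ) (Φ : ℕ → ℝ → ℂ) (n : ℕ) (θ : ℝ) : ℂ :=
  (a : ℂ) * Φ n θ + ((n : ℂ) + 1) * Φ (n + 1) θ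

lemma eulerCoeff_eq_zero_of_lt {a : ℤ} {d : ℕ} {Φ : ℕ → ℝ → ℂ} (hΦ : ∀ n, d < n → Φ n = 0) :
    ∀ n, d < n → eulerCoeff a Φ n = 0 := by
  intro n hn
  funext θ
  simp [eulerCoeff, hΦ n hn, hΦ (n + 1) (by omega)]

lemma continuous_eulerCoeff {a : ℤ} {Φ : ℕ → ℝ → ℂ} (hΦ : ∀ n, Continuous (Φ n)) (n : ℕ) :
    Continuous (eulerCoeff a Φ n) := by
  have h1 := hΦ n
  have h2 := hΦ (n + 1)
  unfold eulerCoeff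
  fun_prop

lemma hasDerivAt_quasiHom {a : ℤ} {d : ℕ} {Φ : ℕ → ℝ → ℂ} (hΦ : ∀ n, d < n → Φ n = 0)
    {r : ℝ} (hr : 0 < r) (θ : ℝ) :
    HasDerivAt (fun ρ => quasiHom a d Φ ρ θ)
      ((r : ℂ)⁻¹ * quasiHom a d (eulerCoeff a Φ) r θ) r := by
  have hr' : (r : ℂ) ≠ 0 := by exact_mod_cast hr.ne'
  have h1 : HasDerivAt (fun ρ : ℝ => (ρ : ℂ) ^ a) ((a : ℂ) * (r : ℂ) ^ (a - 1)) r :=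
    (hasDerivAt_zpow a (r : ℂ) (Or.inl hr')).comp_ofReal
  have hlog : HasDerivAt (fun ρ : ℝ => ((Real.log ρ : ℝ) : ℂ)) ((r⁻¹ : ℝ) : ℂ) r :=
    (Real.hasDerivAt_log hr.ne').ofReal_comp
  have h2 : HasDerivAt (fun ρ : ℝ => ∑ n ∈ Finset.range (d + 1), ((Real.log ρ : ℝ) : ℂ) ^ n * Φ n θ)
      (∑ n ∈ Finset.range (d + 1),
        ((n : ℂ) * ((Real.log r : ℝ) : ℂ) ^ (n - 1) * ((r⁻¹ : ℝ) : ℂ)) * Φ n θ) r :=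
    HasDerivAt.fun_sum fun n _ => (hlog.pow n).mul_const _
  have h3 : ∑ n ∈ Finset.range (d + 1),
        ((n : ℂ) * ((Real.log r : ℝ) : ℂ) ^ (n - 1) * ((r⁻¹ : ℝ) : ℂ)) * Φ n θ =
      (r : ℂ)⁻¹ * ∑ n ∈ Finset.range (d + 1),
        ((Real.log r : ℝ) : ℂ) ^ n * (((n : ℂ) + 1) * Φ (n + 1) θ) := by
    rw [Finset.sum_range_succ', Finset.sum_range_succ _ d, hΦ (d + 1) (by omega)]
    simp only [Finset.mul_sum, mul_add]
    push_cast
    simp only [Pi.zero_apply, mul_zero, zero_mul, add_zero]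
    refine Finset.sum_congr rfl fun n _ => ?_
    ring
  refine (h1.mul h2).congr_deriv ?_
  rw [h3, zpow_sub_one₀ hr']
  simp only [quasiHom, eulerCoeff, mul_add, Finset.sum_add_distrib, Finset.mul_sum]
  congr 1
  · refine Finset.sum_congr rfl fun n _ => ?_
    ring
  · refine Finset.sum_congr rfl fun n _ => ?_
    ring

lemma rDeriv_quasiHom {a : ℤ} {d : ℕ} {Φ : ℕ → ℝ → ℂ} (hΦ : ∀ n, d < n → Φ n = 0)
    {r : ℝ} (hr : 0 < r) (θ : ℝ) :
    rDeriv (quasiHom a d Φ) r θ = quasiHom a d (eulerCoeff a Φ) r θ := by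
  have hr' : (r : ℂ) ≠ 0 := by exact_mod_cast hr.ne'
  rw [rDeriv, (hasDerivAt_quasiHom hΦ hr θ).deriv, mul_inv_cancel_left₀ hr']

lemma rDeriv_congr {u v : ℝ → ℝ → ℂ} {r θ : ℝ} (h : ∀ᶠ ρ in 𝓝 r, u ρ θ = v ρ θ) :
    rDeriv u r θ = rDeriv v r θ := by
  rw [rDeriv, rDeriv, EventuallyEq.deriv_eq h]

lemma rDeriv_rDeriv_quasiHom {a : ℤ} {d : ℕ} {Φ : ℕ → ℝ → ℂ} (hΦ : ∀ n, d < n → Φ n = 0)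
    {r : ℝ} (hr : 0 < r) (θ : ℝ) :
    rDeriv (rDeriv (quasiHom a d Φ)) r θ =
      quasiHom a d (eulerCoeff a (eulerCoeff a Φ)) r θ := by
  rw [← rDeriv_quasiHom (eulerCoeff_eq_zero_of_lt hΦ) hr]
  apply rDeriv_congr
  filter_upwards [lt_mem_nhds hr] with ρ hρ
  exact rDeriv_quasiHom hΦ hρ θ

lemma continuous_quasiHom {a : ℤ} {d : ℕ} {Φ : ℕ → ℝ → ℂ} (hΦ : ∀ n, Continuous (Φ n)) (r : ℝ) :
    Continuous (quasiHom a d Φ r) := by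
  unfold quasiHom
  fun_prop

lemma quasiHom_one {a : ℤ} {d : ℕ} {Φ : ℕ → ℝ → ℂ} (θ : ℝ) :
    quasiHom a d Φ 1 θ = Φ 0 θ := by
  simp [quasiHom, Finset.sum_range_succ']

/-- The angular coefficients of the product of two quasi-homogeneous functions. -/
def mulCoeff (d d' : ℕ) (Ψ Φ : ℕ → ℝ → ℂ) (n : ℕ) (θ : ℝ) : ℂ :=
  ∑ i ∈ Finset.range (d + 1), ∑ j ∈ Finset.range (d' + 1), if i + j = n then Ψ i θ * Φ j θ else 0

lemma mulCoeff_eq_zero_of_lt {d d' : ℕ} {Ψ Φ : ℕ → ℝ → ℂ} :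
    ∀ n, d + d' < n → mulCoeff d d' Ψ Φ n = 0 := by
  intro n hn
  funext θ
  refine Finset.sum_eq_zero fun i hi => Finset.sum_eq_zero fun j hj => if_neg ?_
  simp only [Finset.mem_range] at hi hj
  omega

lemma continuous_mulCoeff {d d' : ℕ} {Ψ Φ : ℕ → ℝ → ℂ} (hΨ : ∀ n, Continuous (Ψ n))
    (hΦ : ∀ n, Continuous (Φ n)) (n : ℕ) : Continuous (mulCoeff d d' Ψ Φ n) := by
  refine continuous_finsetSum _ fun i _ => continuous_finsetSum _ fun j _ => ?_
  split_ifs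
  · exact (hΨ i).mul (hΦ j)
  · exact continuous_const

lemma quasiHom_mul_quasiHom {a b : ℤ} {d d' : ℕ} {Ψ Φ : ℕ → ℝ → ℂ} {r : ℝ} (hr : 0 < r) (θ : ℝ) :
    quasiHom a d Ψ r θ * quasiHom b d' Φ r θ =
      quasiHom (a + b) (d + d') (mulCoeff d d' Ψ Φ) r θ := by
  have hr' : (r : ℂ) ≠ 0 := by exact_mod_cast hr.ne'
  have key : ∑ n ∈ Finset.range (d + d' + 1), ((Real.log r : ℝ) : ℂ) ^ n * mulCoeff d d' Ψ Φ n θ =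
      (∑ n ∈ Finset.range (d + 1), ((Real.log r : ℝ) : ℂ) ^ n * Ψ n θ) *
        ∑ n ∈ Finset.range (d' + 1), ((Real.log r : ℝ) : ℂ) ^ n * Φ n θ := by
    rw [Finset.sum_mul_sum]
    simp only [mulCoeff, Finset.mul_sum]
    rw [Finset.sum_comm]
    refine Finset.sum_congr rfl fun i hi => ?_
    rw [Finset.sum_comm]
    refine Finset.sum_congr rfl fun j hj => ?_
    simp only [Finset.mem_range] at hi hj
    rw [Finset.sum_eq_single (i + j)]
    · rw [if_pos rfl, pow_add]; ring
    · intro n _ hn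
      rw [if_neg (Ne.symm hn), mul_zero]
    · intro h
      exact absurd (Finset.mem_range.2 (by omega)) h
  rw [quasiHom, quasiHom, quasiHom, zpow_add₀ hr', key]
  ring

lemma integral_quasiHom {a : ℤ} {d : ℕ} {Φ : ℕ → ℝ → ℂ} (hΦ : ∀ n, Continuous (Φ n))
    (α β r θ : ℝ) :
    ∫ t in α..β, quasiHom a d Φ r t = quasiHom a d (fun n _ => ∫ t in α..β, Φ n t) r θ := by
  simp only [quasiHom]
  rw [intervalIntegral.integral_const_mul, intervalIntegral.integral_finsetSum]
  · simp only [intervalIntegral.integral_const_mul]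
  · intro n _
    exact ((hΦ n).const_smul (((Real.log r : ℝ) : ℂ) ^ n)).intervalIntegrable _ _

/-- Differentiation under the integral for quasi-homogeneous functions. -/
lemma hasDerivAt_integral_quasiHom {a : ℤ} {d : ℕ} {Φ : ℕ → ℝ → ℂ} (hc : ∀ n, Continuous (Φ n))
    (hΦ : ∀ n, d < n → Φ n = 0) (α β : ℝ) {r : ℝ} (hr : 0 < r) :
    HasDerivAt (fun ρ => ∫ t in α..β, quasiHom a d Φ ρ t)
      ((r : ℂ)⁻¹ * ∫ t in α..β, quasiHom a d (eulerCoeff a Φ) r t) r := by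
  simp only [integral_quasiHom hc α β _ 0, integral_quasiHom (continuous_eulerCoeff hc) α β _ 0]
  have h := hasDerivAt_quasiHom (a := a) (d := d) (Φ := fun n _ => ∫ t in α..β, Φ n t)
    (fun n hn => by funext; simp [hΦ n hn]) hr 0
  convert h using 3
  funext n θ
  simp only [eulerCoeff]
  rw [intervalIntegral.integral_add, intervalIntegral.integral_const_mul,
    intervalIntegral.integral_const_mul]
  · exact ((hc n).const_smul (a : ℂ)).intervalIntegrable _ _
  · exact ((hc (n + 1)).const_smul ((n : ℂ) + 1)).intervalIntegrable _ _

lemma hasDerivAt_integral_mul_quasiHom {a b : ℤ} {d d' : ℕ} {Ψ Φ : ℕ → ℝ → ℂ}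
    (hΨc : ∀ n, Continuous (Ψ n)) (hΨ : ∀ n, d < n → Ψ n = 0)
    (hΦc : ∀ n, Continuous (Φ n)) (hΦ : ∀ n, d' < n → Φ n = 0) (α β : ℝ) {r : ℝ} (hr : 0 < r) :
    HasDerivAt (fun ρ => ∫ t in α..β, quasiHom a d Ψ ρ t * quasiHom b d' Φ ρ t)
      ((r : ℂ)⁻¹ * ((∫ t in α..β, quasiHom a d (eulerCoeff a Ψ) r t * quasiHom b d' Φ r t) +
        ∫ t in α..β, quasiHom a d Ψ r t * quasiHom b d' (eulerCoeff b Φ) r t)) r := by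
  have h := hasDerivAt_integral_quasiHom (a := a + b) (continuous_mulCoeff (d := d) (d' := d') hΨc hΦc)
    mulCoeff_eq_zero_of_lt α β hr
  have e : ∀ t, quasiHom (a + b) (d + d') (eulerCoeff (a + b) (mulCoeff d d' Ψ Φ)) r t =
      quasiHom a d (eulerCoeff a Ψ) r t * quasiHom b d' Φ r t +
        quasiHom a d Ψ r t * quasiHom b d' (eulerCoeff b Φ) r t := by
    intro t
    have h1 := hasDerivAt_quasiHom (a := a + b) (mulCoeff_eq_zero_of_lt (d := d) (d' := d')
      (Ψ := Ψ) (Φ := Φ)) hr t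
    have h2 := (hasDerivAt_quasiHom (a := a) hΨ hr t).mul (hasDerivAt_quasiHom (a := b) hΦ hr t)
    have h3 := (h2.congr_of_eventuallyEq (f₁ := fun ρ =>
      quasiHom (a + b) (d + d') (mulCoeff d d' Ψ Φ) ρ t) (by
        filter_upwards [lt_mem_nhds hr] with ρ hρ
        exact (quasiHom_mul_quasiHom hρ t).symm)).unique h1
    have hr' : (r : ℂ)⁻¹ ≠ 0 := inv_ne_zero (by exact_mod_cast hr.ne')
    apply mul_left_cancel₀ hr'
    rw [← h3]
    ring
  rw [← intervalIntegral.integral_add]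
  · simp only [← e]
    refine h.congr_of_eventuallyEq ?_
    filter_upwards [lt_mem_nhds hr] with ρ hρ
    simp only [quasiHom_mul_quasiHom hρ]
  · exact ((continuous_quasiHom (continuous_eulerCoeff hΨc) r).mul
      (continuous_quasiHom hΦc r)).intervalIntegrable _ _
  · exact ((continuous_quasiHom hΨc r).mul
      (continuous_quasiHom (continuous_eulerCoeff hΦc) r)).intervalIntegrable _ _

/-- The `j`-th term `r ^ (a + 2j) ∑_{n ≤ deg j} (log r) ^ n Φ_{j,n}(θ)` of a formal series. -/
def shadowTerm (a : ℤ) (deg : ℕ → ℕ) (Φ : ℕ → ℕ → ℝ → ℂ) (j : ℕ) : ℝ → ℝ → ℂ :=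
  quasiHom (a + 2 * j) (deg j) (Φ j)

/-- A harmonic quasi-homogeneous leading term followed by its shadows; this covers both the primal
and the dual singular functions. -/
structure IsShadowFamily (ω : ℝ) (a : ℤ) (deg : ℕ → ℕ) (Φ : ℕ → ℕ → ℝ → ℂ) : Prop where
  angular : ∀ j n, IsAngular ω (Φ j n)
  eq_zero_of_lt : ∀ j n, deg j < n → Φ j n = 0
  harmonic : ∀ r : ℝ, 0 < r → ∀ θ, polarLaplacian (shadowTerm a deg Φ 0) r θ = 0
  shadow : IsShadowSequence ω (shadowTerm a deg Φ)

lemma IsShadowFamily.continuous {ω : ℝ} {a : ℤ} {deg : ℕ → ℕ} {Φ : ℕ → ℕ → ℝ → ℂ}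
    (h : IsShadowFamily ω a deg Φ) (j n : ℕ) : Continuous (Φ j n) :=
  (h.angular j n).contDiff_one.continuous

lemma polarLaplacian_quasiHom_zero_eq_zero {b : ℤ} {Φ : ℕ → ℝ → ℂ} (hΦ : ∀ n, 0 < n → Φ n = 0)
    {c κ φ : ℝ} (hκ : κ ^ 2 = (b : ℝ) ^ 2)
    (h0 : ∀ θ, Φ 0 θ = ((c * Real.cos (κ * θ - φ) : ℝ) : ℂ)) {r : ℝ} (hr : 0 < r) (θ : ℝ) :
    polarLaplacian (quasiHom b 0 Φ) r θ = 0 := by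
  have h1 : ∀ t : ℝ, HasDerivAt (fun t' => quasiHom b 0 Φ r t')
      ((r : ℂ) ^ b * ((c * (-Real.sin (κ * t - φ) * κ) : ℝ) : ℂ)) t := by
    intro t
    have e : (fun t' => quasiHom b 0 Φ r t') =
        fun t' : ℝ => (r : ℂ) ^ b * ((c * Real.cos (κ * t' - φ) : ℝ) : ℂ) := by
      funext t'
      simp [quasiHom, h0]
    rw [e]
    have h : HasDerivAt (fun t' : ℝ => κ * t' - φ) κ t := by
      simpa using ((hasDerivAt_id t).const_mul κ).sub_const φ
    exact ((h.cos.const_mul c).ofReal_comp).const_mul _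
  have h2 : HasDerivAt (fun t => deriv (fun t' => quasiHom b 0 Φ r t') t)
      ((r : ℂ) ^ b * ((c * (-(Real.cos (κ * θ - φ) * κ) * κ) : ℝ) : ℂ)) θ := by
    have e : (fun t => deriv (fun t' => quasiHom b 0 Φ r t') t) =
        fun t : ℝ => (r : ℂ) ^ b * ((c * (-Real.sin (κ * t - φ) * κ) : ℝ) : ℂ) := by
      funext t
      exact (h1 t).deriv
    rw [e]
    have h : HasDerivAt (fun t' : ℝ => κ * t' - φ) κ θ := by
      simpa using ((hasDerivAt_id θ).const_mul κ).sub_const φ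
    exact (((h.sin.neg.mul_const κ).const_mul c).ofReal_comp).const_mul _
  have hκ' : (κ : ℂ) ^ 2 = (b : ℂ) ^ 2 := by exact_mod_cast hκ
  rw [polarLaplacian, rDeriv_rDeriv_quasiHom hΦ hr, h2.deriv]
  simp [quasiHom, eulerCoeff, hΦ 1 one_pos, hΦ 2 two_pos, h0]
  right
  linear_combination (-(c : ℂ) * Complex.cos (κ * θ - φ) * (r : ℂ) ^ b) * hκ'

lemma IsPrimalSingularity.leading_coeff {ω : ℝ} {k : ℕ} {p : Fin 2} {Φ : ℕ → ℕ → ℝ → ℂ}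
    (h : IsPrimalSingularity ω k p Φ) (θ : ℝ) :
    Φ 0 0 θ = ((1 * Real.cos (k * θ - ((p : ℕ) : ℝ) * Real.pi / 2) : ℝ) : ℂ) := by
  have := h.leading 1 one_pos θ
  rwa [primalTerm, quasiHom_one, primalLeading, one_pow] at this

lemma IsDualSingularity.leading_coeff {ω : ℝ} {k : ℕ} {p : Fin 2} {Ψ : ℕ → ℕ → ℝ → ℂ}
    (h : IsDualSingularity ω k p Ψ) (hk : k ≠ 0) (θ : ℝ) :
    Ψ 0 0 θ = ((1 / (2 * k * Real.pi) *
      Real.cos (k * θ - ((p : ℕ) : ℝ) * Real.pi / 2) : ℝ) : ℂ) := by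
  have := h.leading 1 one_pos θ
  rwa [dualTerm, quasiHom_one, dualLeading, if_neg hk, one_zpow, mul_one] at this

lemma IsPrimalSingularity.isShadowFamily {ω : ℝ} {k : ℕ} {p : Fin 2} {Φ : ℕ → ℕ → ℝ → ℂ}
    (h : IsPrimalSingularity ω k p Φ) : IsShadowFamily ω k (fun j => j) Φ where
  angular := h.angular
  eq_zero_of_lt := h.eq_zero_of_lt
  harmonic r hr θ :=
    polarLaplacian_quasiHom_zero_eq_zero (h.eq_zero_of_lt 0) (by simp) h.leading_coeff hr θ
  shadow := h.shadow

lemma IsDualSingularity.isShadowFamily {ω : ℝ} {k : ℕ} {p : Fin 2} {Ψ : ℕ → ℕ → ℝ → ℂ}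
    (h : IsDualSingularity ω k p Ψ) (hk : k ≠ 0) :
    IsShadowFamily ω (-(k : ℤ)) (dualDegree k) Ψ where
  angular := h.angular
  eq_zero_of_lt := h.eq_zero_of_lt
  harmonic r hr θ := by
    have h0 : dualDegree k 0 = 0 := by
      rw [dualDegree, if_pos (Or.inr (by omega))]
    rw [shadowTerm, h0]
    exact polarLaplacian_quasiHom_zero_eq_zero (fun n hn => h.eq_zero_of_lt 0 n (by omega)) (by simp)
      (h.leading_coeff hk) hr θ
  shadow := h.shadow

/-- On each open sector `∂_θ² u = r² Δu - (r ∂_r)² u` holds for a quasi-homogeneous `u`. -/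
lemma hasDerivAt_deriv_quasiHom {ω : ℝ} {a : ℤ} {d : ℕ} {Φ : ℕ → ℝ → ℂ}
    (hΦ : ∀ n, IsAngular ω (Φ n)) (hz : ∀ n, d < n → Φ n = 0) {r : ℝ} (hr : 0 < r) {θ : ℝ}
    (hθ : θ ∈ Set.Ioo (-(ω / 2)) (ω / 2) ∨ θ ∈ Set.Ioo (ω / 2) (2 * Real.pi - ω / 2)) :
    HasDerivAt (fun t => deriv (quasiHom a d Φ r) t)
      ((r : ℂ) ^ 2 * polarLaplacian (quasiHom a d Φ) r θ -
        quasiHom a d (eulerCoeff a (eulerCoeff a Φ)) r θ) θ := by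
  have hle : (2 : WithTop ℕ∞) ≤ ((⊤ : ℕ∞) : WithTop ℕ∞) :=
    WithTop.coe_le_coe.2 (le_top (a := (2 : ℕ∞)))
  have hsm : ∀ n, ContDiffAt ℝ 2 (Φ n) θ := by
    intro n
    rcases hθ with hθ | hθ
    · exact ((hΦ n).smooth_minus.contDiffAt (Icc_mem_nhds hθ.1 hθ.2)).of_le hle
    · exact ((hΦ n).smooth_plus.contDiffAt (Icc_mem_nhds hθ.1 hθ.2)).of_le hle
  have hq : ContDiffAt ℝ 2 (quasiHom a d Φ r) θ := by
    unfold quasiHom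
    exact contDiffAt_const.mul (ContDiffAt.sum fun n _ => contDiffAt_const.mul (hsm n))
  have hd : DifferentiableAt ℝ (deriv (quasiHom a d Φ r)) θ := by
    have h := (hq.fderiv_right (m := 1) (by norm_num)).differentiableAt (by norm_num)
    exact h.clm_apply (differentiableAt_const (1 : ℝ))
  refine hd.hasDerivAt.congr_deriv ?_
  have hr' : (r : ℂ) ≠ 0 := by exact_mod_cast hr.ne'
  rw [polarLaplacian, rDeriv_rDeriv_quasiHom hz hr]
  rw [mul_inv_cancel_left₀ (pow_ne_zero 2 hr'), add_sub_cancel_left]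

lemma contDiff_quasiHom {ω : ℝ} {a : ℤ} {d : ℕ} {Φ : ℕ → ℝ → ℂ} (hΦ : ∀ n, IsAngular ω (Φ n))
    (r : ℝ) : ContDiff ℝ 1 (quasiHom a d Φ r) := by
  unfold quasiHom
  exact contDiff_const.mul (ContDiff.sum fun n _ => contDiff_const.mul (hΦ n).contDiff_one)

lemma periodic_quasiHom {a : ℤ} {d : ℕ} {Φ : ℕ → ℝ → ℂ} {T : ℝ}
    (hΦ : ∀ n, Function.Periodic (Φ n) T) (r : ℝ) : Function.Periodic (quasiHom a d Φ r) T := by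
  intro θ
  simp only [quasiHom, hΦ _ θ]

lemma IsAngular.periodic_eulerCoeff {ω : ℝ} {a : ℤ} {Φ : ℕ → ℝ → ℂ} (hΦ : ∀ n, IsAngular ω (Φ n))
    (n : ℕ) : Function.Periodic (eulerCoeff a Φ n) (2 * Real.pi) := by
  intro θ
  simp only [eulerCoeff, (hΦ _).periodic θ]

lemma periodic_deriv {f : ℝ → ℂ} {T : ℝ} (hf : Function.Periodic f T) :
    Function.Periodic (deriv f) T := by
  intro θ
  rw [← deriv_comp_add_const f T θ]
  congr 1
  funext t
  exact hf t

lemma IsShadowFamily.sq_mul_polarLaplacian {ω : ℝ} {a : ℤ} {deg : ℕ → ℕ} {Φ : ℕ → ℕ → ℝ → ℂ}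
    (h : IsShadowFamily ω a deg Φ) {r : ℝ} (hr : 0 < r) {θ : ℝ} {c : ℂ}
    (hθ : (θ ∈ Set.Ioo (-(ω / 2)) (ω / 2) ∧ c = (r : ℂ) ^ 2 * 4) ∨
      (θ ∈ Set.Ioo (ω / 2) (2 * Real.pi - ω / 2) ∧ c = 0)) (j : ℕ) :
    (r : ℂ) ^ 2 * polarLaplacian (shadowTerm a deg Φ j) r θ =
      c * (if j = 0 then 0 else shadowTerm a deg Φ (j - 1) r θ) := by
  cases j with
  | zero => simp [h.harmonic r hr θ]
  | succ j =>
    rcases hθ with ⟨hθ, rfl⟩ | ⟨hθ, rfl⟩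
    · rw [h.shadow.2 j r hr θ hθ, if_neg (Nat.succ_ne_zero j), add_tsub_cancel_right, mul_assoc]
    · rw [h.shadow.1 j r hr θ hθ]
      simp

lemma sum_antidiagonal_shift (f g : ℕ → ℂ) (n : ℕ) :
    ∑ x ∈ Finset.HasAntidiagonal.antidiagonal n, (g x.1 * (if x.2 = 0 then 0 else f (x.2 - 1)) -
      f x.2 * (if x.1 = 0 then 0 else g (x.1 - 1))) = 0 := by
  rw [Finset.sum_sub_distrib]
  cases n with
  | zero => simp
  | succ n =>
    rw [Finset.Nat.sum_antidiagonal_succ', Finset.Nat.sum_antidiagonal_succ]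
    simp only [if_true, mul_zero, Nat.succ_ne_zero, if_false, add_tsub_cancel_right, zero_add]
    simp [mul_comm]

/-- Green's formula on the circle of radius `r`: by the shadow equations the contributions of the
conductor telescope along antidiagonals. -/
lemma integral_sum_antidiagonal_eulerCoeff {ω : ℝ} {a b : ℤ}
    {deg deg' : ℕ → ℕ} {Ψ Φ : ℕ → ℕ → ℝ → ℂ} (hΨ : IsShadowFamily ω a deg Ψ)
    (hΦ : IsShadowFamily ω b deg' Φ) (n : ℕ) {r : ℝ} (hr : 0 < r) :
    ∫ θ in (0 : ℝ)..(2 * Real.pi), ∑ x ∈ Finset.HasAntidiagonal.antidiagonal n,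
      (shadowTerm a deg Ψ x.1 r θ * quasiHom (b + 2 * x.2) (deg' x.2)
          (eulerCoeff (b + 2 * x.2) (eulerCoeff (b + 2 * x.2) (Φ x.2))) r θ -
        shadowTerm b deg' Φ x.2 r θ * quasiHom (a + 2 * x.1) (deg x.1)
          (eulerCoeff (a + 2 * x.1) (eulerCoeff (a + 2 * x.1) (Ψ x.1))) r θ) = 0 := by
  set h : ℝ → ℂ := fun θ => ∑ x ∈ Finset.HasAntidiagonal.antidiagonal n,
      (shadowTerm a deg Ψ x.1 r θ * quasiHom (b + 2 * x.2) (deg' x.2)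
          (eulerCoeff (b + 2 * x.2) (eulerCoeff (b + 2 * x.2) (Φ x.2))) r θ -
        shadowTerm b deg' Φ x.2 r θ * quasiHom (a + 2 * x.1) (deg x.1)
          (eulerCoeff (a + 2 * x.1) (eulerCoeff (a + 2 * x.1) (Ψ x.1))) r θ) with hh
  set W : ℝ → ℂ := fun θ => ∑ x ∈ Finset.HasAntidiagonal.antidiagonal n,
      (shadowTerm a deg Ψ x.1 r θ * deriv (shadowTerm b deg' Φ x.2 r) θ -
        shadowTerm b deg' Φ x.2 r θ * deriv (shadowTerm a deg Ψ x.1 r) θ) with hW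
  have hΨC : ∀ j, ContDiff ℝ 1 (shadowTerm a deg Ψ j r) := fun j =>
    contDiff_quasiHom (hΨ.angular j) r
  have hΦC : ∀ j, ContDiff ℝ 1 (shadowTerm b deg' Φ j r) := fun j =>
    contDiff_quasiHom (hΦ.angular j) r
  have hΨP : ∀ j, Function.Periodic (shadowTerm a deg Ψ j r) (2 * Real.pi) := fun j =>
    periodic_quasiHom (fun n => (hΨ.angular j n).periodic) r
  have hΦP : ∀ j, Function.Periodic (shadowTerm b deg' Φ j r) (2 * Real.pi) := fun j =>
    periodic_quasiHom (fun n => (hΦ.angular j n).periodic) r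
  have hhc : Continuous h := by
    refine continuous_finsetSum _ fun x _ => Continuous.sub ?_ ?_
    · exact (hΨC _).continuous.mul (continuous_quasiHom
        (continuous_eulerCoeff (continuous_eulerCoeff (hΦ.continuous _))) r)
    · exact (hΦC _).continuous.mul (continuous_quasiHom
        (continuous_eulerCoeff (continuous_eulerCoeff (hΨ.continuous _))) r)
  have hWc : Continuous W := by
    refine continuous_finsetSum _ fun x _ => Continuous.sub ?_ ?_
    · exact (hΨC _).continuous.mul ((hΦC _).continuous_deriv le_rfl)
    · exact (hΦC _).continuous.mul ((hΨC _).continuous_deriv le_rfl)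
  have hhP : Function.Periodic h (2 * Real.pi) := by
    intro θ
    refine Finset.sum_congr rfl fun x _ => ?_
    rw [hΨP _ θ, hΦP _ θ]
    congr 2
    · refine periodic_quasiHom (fun n θ => ?_) r θ
      simp only [eulerCoeff, (hΦ.angular _ _).periodic θ]
    · refine periodic_quasiHom (fun n θ => ?_) r θ
      simp only [eulerCoeff, (hΨ.angular _ _).periodic θ]
  have hWP : W (-(ω / 2) + 2 * Real.pi) = W (-(ω / 2)) := by
    refine Finset.sum_congr rfl fun x _ => ?_
    rw [hΨP _ _, hΦP _ _, periodic_deriv (hΨP _), periodic_deriv (hΦP _)]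
  have hd : ∀ θ ∈ Set.Ioo (-(ω / 2)) (-(ω / 2) + 2 * Real.pi) \ {ω / 2},
      HasDerivAt W (-h θ) θ := by
    rintro θ ⟨hθ, hne⟩
    obtain ⟨c, hc⟩ : ∃ c : ℂ, (θ ∈ Set.Ioo (-(ω / 2)) (ω / 2) ∧ c = (r : ℂ) ^ 2 * 4) ∨
        (θ ∈ Set.Ioo (ω / 2) (2 * Real.pi - ω / 2) ∧ c = 0) := by
      rcases lt_or_gt_of_ne hne with h | h
      · exact ⟨_, Or.inl ⟨⟨hθ.1, h⟩, rfl⟩⟩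
      · exact ⟨_, Or.inr ⟨⟨h, by linarith [hθ.2]⟩, rfl⟩⟩
    have hc' := hc.imp And.left And.left
    have key : HasDerivAt W _ θ := HasDerivAt.fun_sum fun x _ =>
      (((hΨC x.1).differentiable (one_ne_zero) θ).hasDerivAt.mul
          (hasDerivAt_deriv_quasiHom (hΦ.angular x.2) (hΦ.eq_zero_of_lt x.2) hr hc')).sub
        (((hΦC x.2).differentiable (one_ne_zero) θ).hasDerivAt.mul
          (hasDerivAt_deriv_quasiHom (hΨ.angular x.1) (hΨ.eq_zero_of_lt x.1) hr hc'))
    refine key.congr_deriv ?_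
    rw [hh, ← Finset.sum_neg_distrib, ← sub_eq_zero, ← Finset.sum_sub_distrib,
      ← mul_zero c, ← sum_antidiagonal_shift (fun j => shadowTerm b deg' Φ j r θ)
        (fun j => shadowTerm a deg Ψ j r θ) n, Finset.mul_sum]
    refine Finset.sum_congr rfl fun x _ => ?_
    have e1 := hΦ.sq_mul_polarLaplacian hr hc x.2
    have e2 := hΨ.sq_mul_polarLaplacian hr hc x.1
    simp only [shadowTerm] at e1 e2 ⊢
    linear_combination (quasiHom (a + 2 * x.1) (deg x.1) (Ψ x.1) r θ) * e1 -
      (quasiHom (b + 2 * x.2) (deg' x.2) (Φ x.2) r θ) * e2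
  have hint := MeasureTheory.integral_eq_of_hasDerivAt_off_countable_of_le W (fun θ => -h θ)
    (by linarith [Real.pi_pos] : -(ω / 2) ≤ -(ω / 2) + 2 * Real.pi)
    (Set.countable_singleton (ω / 2)) hWc.continuousOn hd (hhc.neg.intervalIntegrable _ _)
  rw [hWP, sub_self, intervalIntegral.integral_neg, neg_eq_zero] at hint
  have := hhP.intervalIntegral_add_eq 0 (-(ω / 2))
  rw [zero_add] at this
  rw [this, hint]

/-- The regularity on the circle of radius `R` under which `dualForm R` is bilinear. -/
structure IsRadiallyRegular (R : ℝ) (u : ℝ → ℝ → ℂ) : Prop where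
  differentiableAt : ∀ θ, DifferentiableAt ℝ (fun r => u r θ) R
  continuous : Continuous (u R)
  continuous_rDeriv : Continuous (rDeriv u R)

lemma isRadiallyRegular_quasiHom {a : ℤ} {d : ℕ} {Φ : ℕ → ℝ → ℂ} (hc : ∀ n, Continuous (Φ n))
    (hΦ : ∀ n, d < n → Φ n = 0) {R : ℝ} (hR : 0 < R) : IsRadiallyRegular R (quasiHom a d Φ) where
  differentiableAt θ := (hasDerivAt_quasiHom hΦ hR θ).differentiableAt
  continuous := continuous_quasiHom hc R
  continuous_rDeriv := by
    rw [show rDeriv (quasiHom a d Φ) R = quasiHom a d (eulerCoeff a Φ) R from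
      funext fun θ => rDeriv_quasiHom hΦ hR θ]
    exact continuous_quasiHom (continuous_eulerCoeff hc) R

lemma rDeriv_const_mul {u : ℝ → ℝ → ℂ} {R θ : ℝ} (c : ℂ)
    (h : DifferentiableAt ℝ (fun r => u r θ) R) :
    rDeriv (fun r θ => c * u r θ) R θ = c * rDeriv u R θ := by
  rw [rDeriv, rDeriv, deriv_const_mul c h]
  ring

lemma rDeriv_fun_sum {ι : Type*} {s : Finset ι} {u : ι → ℝ → ℝ → ℂ} {R θ : ℝ}
    (h : ∀ i ∈ s, DifferentiableAt ℝ (fun r => u i r θ) R) :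
    rDeriv (fun r θ => ∑ i ∈ s, u i r θ) R θ = ∑ i ∈ s, rDeriv (u i) R θ := by
  simp only [rDeriv]
  rw [deriv_fun_sum h, Finset.mul_sum]

lemma rDeriv_fun_sub {u v : ℝ → ℝ → ℂ} {R θ : ℝ} (hu : DifferentiableAt ℝ (fun r => u r θ) R)
    (hv : DifferentiableAt ℝ (fun r => v r θ) R) :
    rDeriv (fun r θ => u r θ - v r θ) R θ = rDeriv u R θ - rDeriv v R θ := by
  simp only [rDeriv]
  rw [deriv_fun_sub hu hv, mul_sub]

namespace IsRadiallyRegular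

variable {R : ℝ} {u v K A : ℝ → ℝ → ℂ}

lemma const_mul (h : IsRadiallyRegular R u) (c : ℂ) :
    IsRadiallyRegular R (fun r θ => c * u r θ) where
  differentiableAt θ := (h.differentiableAt θ).const_mul c
  continuous := h.continuous.const_smul c
  continuous_rDeriv := by
    rw [show rDeriv (fun r θ => c * u r θ) R = fun θ => c * rDeriv u R θ from
      funext fun θ => rDeriv_const_mul c (h.differentiableAt θ)]
    exact h.continuous_rDeriv.const_smul c

lemma sum {ι : Type*} {s : Finset ι} {u : ι → ℝ → ℝ → ℂ} (h : ∀ i ∈ s, IsRadiallyRegular R (u i)) :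
    IsRadiallyRegular R (fun r θ => ∑ i ∈ s, u i r θ) where
  differentiableAt θ := DifferentiableAt.fun_sum fun i hi => (h i hi).differentiableAt θ
  continuous := continuous_finsetSum _ fun i hi => (h i hi).continuous
  continuous_rDeriv := by
    rw [show rDeriv (fun r θ => ∑ i ∈ s, u i r θ) R = fun θ => ∑ i ∈ s, rDeriv (u i) R θ from
      funext fun θ => rDeriv_fun_sum fun i hi => (h i hi).differentiableAt θ]
    exact continuous_finsetSum _ fun i hi => (h i hi).continuous_rDeriv

lemma sub (hu : IsRadiallyRegular R u) (hv : IsRadiallyRegular R v) :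
    IsRadiallyRegular R (fun r θ => u r θ - v r θ) where
  differentiableAt θ := (hu.differentiableAt θ).fun_sub (hv.differentiableAt θ)
  continuous := hu.continuous.sub hv.continuous
  continuous_rDeriv := by
    rw [show rDeriv (fun r θ => u r θ - v r θ) R = fun θ => rDeriv u R θ - rDeriv v R θ from
      funext fun θ => rDeriv_fun_sub (hu.differentiableAt θ) (hv.differentiableAt θ)]
    exact hu.continuous_rDeriv.sub hv.continuous_rDeriv

end IsRadiallyRegular

lemma dualForm_eq_integral_rDeriv (R : ℝ) (K A : ℝ → ℝ → ℂ) :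
    dualForm R K A =
      ∫ θ in (0 : ℝ)..(2 * Real.pi), (K R θ * rDeriv A R θ - A R θ * rDeriv K R θ) := by
  simp only [dualForm, rDeriv]
  congr 1
  funext θ
  ring

lemma dualForm_swap (R : ℝ) (K A : ℝ → ℝ → ℂ) : dualForm R K A = -dualForm R A K := by
  rw [dualForm, dualForm, ← intervalIntegral.integral_neg]
  congr 1
  funext θ
  ring

lemma dualForm_const_mul_right {R : ℝ} {A : ℝ → ℝ → ℂ} (K : ℝ → ℝ → ℂ)
    (hA : IsRadiallyRegular R A) (c : ℂ) :
    dualForm R K (fun r θ => c * A r θ) = c * dualForm R K A := by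
  rw [dualForm_eq_integral_rDeriv, dualForm_eq_integral_rDeriv,
    ← intervalIntegral.integral_const_mul]
  congr 1
  funext θ
  rw [rDeriv_const_mul c (hA.differentiableAt θ)]
  ring

lemma intervalIntegrable_dualForm {R : ℝ} {K A : ℝ → ℝ → ℂ} (hK : IsRadiallyRegular R K)
    (hA : IsRadiallyRegular R A) (α β : ℝ) : IntervalIntegrable
      (fun θ => K R θ * rDeriv A R θ - A R θ * rDeriv K R θ) MeasureTheory.volume α β :=
  ((hK.continuous.mul hA.continuous_rDeriv).sub
    (hA.continuous.mul hK.continuous_rDeriv)).intervalIntegrable _ _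

lemma dualForm_sum_right {R : ℝ} {ι : Type*} {s : Finset ι} {K : ℝ → ℝ → ℂ} {A : ι → ℝ → ℝ → ℂ}
    (hK : IsRadiallyRegular R K) (hA : ∀ i ∈ s, IsRadiallyRegular R (A i)) :
    dualForm R K (fun r θ => ∑ i ∈ s, A i r θ) = ∑ i ∈ s, dualForm R K (A i) := by
  simp only [dualForm_eq_integral_rDeriv]
  rw [← intervalIntegral.integral_finsetSum fun i hi => intervalIntegrable_dualForm hK (hA i hi) _ _]
  congr 1
  funext θ
  rw [rDeriv_fun_sum fun i hi => (hA i hi).differentiableAt θ, Finset.mul_sum, Finset.sum_mul,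
    Finset.sum_sub_distrib]

lemma dualForm_sub_right {R : ℝ} {K A B : ℝ → ℝ → ℂ} (hK : IsRadiallyRegular R K)
    (hA : IsRadiallyRegular R A) (hB : IsRadiallyRegular R B) :
    dualForm R K (fun r θ => A r θ - B r θ) = dualForm R K A - dualForm R K B := by
  simp only [dualForm_eq_integral_rDeriv]
  rw [← intervalIntegral.integral_sub (intervalIntegrable_dualForm hK hA _ _)
    (intervalIntegrable_dualForm hK hB _ _)]
  congr 1
  funext θ
  rw [rDeriv_fun_sub (hA.differentiableAt θ) (hB.differentiableAt θ)]
  ring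

lemma dualForm_sum_const_mul {R : ℝ} {s t : Finset ℕ} {K A : ℕ → ℝ → ℝ → ℂ}
    (hK : ∀ j, IsRadiallyRegular R (K j)) (hA : ∀ i, IsRadiallyRegular R (A i)) (z : ℂ) :
    dualForm R (fun r θ => ∑ j ∈ s, z ^ j * K j r θ) (fun r θ => ∑ i ∈ t, z ^ i * A i r θ) =
      ∑ j ∈ s, ∑ i ∈ t, z ^ (j + i) * dualForm R (K j) (A i) := by
  rw [dualForm_sum_right (IsRadiallyRegular.sum fun j _ => (hK j).const_mul _)
    fun i _ => (hA i).const_mul _, Finset.sum_comm]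
  refine Finset.sum_congr rfl fun i _ => ?_
  rw [dualForm_const_mul_right _ (hA i), dualForm_swap,
    dualForm_sum_right (hA i) fun j _ => (hK j).const_mul _, mul_neg, Finset.mul_sum,
    ← Finset.sum_neg_distrib]
  refine Finset.sum_congr rfl fun j _ => ?_
  rw [dualForm_const_mul_right _ (hK j), dualForm_swap R (K j) (A i)]
  ring

lemma norm_dualForm_le {R : ℝ} {K A : ℝ → ℝ → ℂ} {B C : ℝ} (hK : ∀ θ, ‖K R θ‖ ≤ B)
    (hK' : ∀ θ, ‖rDeriv K R θ‖ ≤ B) (hA : ∀ θ, ‖A R θ‖ ≤ C) (hA' : ∀ θ, ‖rDeriv A R θ‖ ≤ C) :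
    ‖dualForm R K A‖ ≤ 4 * Real.pi * (B * C) := by
  have hB : 0 ≤ B := (norm_nonneg _).trans (hK 0)
  have hC : 0 ≤ C := (norm_nonneg _).trans (hA 0)
  rw [dualForm_eq_integral_rDeriv]
  refine (intervalIntegral.norm_integral_le_of_norm_le_const (C := 2 * (B * C)) fun θ _ => ?_).trans
    (le_of_eq ?_)
  · refine (norm_sub_le _ _).trans ?_
    rw [norm_mul, norm_mul, two_mul]
    refine add_le_add (mul_le_mul (hK θ) (hA' θ) (norm_nonneg _) hB) ?_
    rw [mul_comm B C]
    exact mul_le_mul (hA θ) (hK' θ) (norm_nonneg _) hC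
  · rw [sub_zero, abs_of_pos Real.two_pi_pos]
    ring

/-- The angular part of `dualForm` for quasi-homogeneous functions. -/
lemma exists_dualForm_quasiHom {a b : ℤ} {d d' : ℕ} {Ψ Φ : ℕ → ℝ → ℂ}
    (hΨc : ∀ n, Continuous (Ψ n)) (hΨ : ∀ n, d < n → Ψ n = 0)
    (hΦc : ∀ n, Continuous (Φ n)) (hΦ : ∀ n, d' < n → Φ n = 0) :
    ∃ c : ℕ → ℂ, ∀ R : ℝ, 0 < R → dualForm R (quasiHom a d Ψ) (quasiHom b d' Φ) =
      (R : ℂ) ^ (a + b) * ∑ n ∈ Finset.range (d + d' + 1), ((Real.log R : ℝ) : ℂ) ^ n * c n := by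
  have hc1 := continuous_mulCoeff (d := d) (d' := d') hΨc (continuous_eulerCoeff (a := b) hΦc)
  have hc2 := continuous_mulCoeff (d := d) (d' := d') (continuous_eulerCoeff (a := a) hΨc) hΦc
  refine ⟨fun n => (∫ t in (0 : ℝ)..(2 * Real.pi), mulCoeff d d' Ψ (eulerCoeff b Φ) n t) -
    ∫ t in (0 : ℝ)..(2 * Real.pi), mulCoeff d d' (eulerCoeff a Ψ) Φ n t, fun R hR => ?_⟩
  rw [dualForm_eq_integral_rDeriv]
  have e : ∀ θ, quasiHom a d Ψ R θ * rDeriv (quasiHom b d' Φ) R θ -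
      quasiHom b d' Φ R θ * rDeriv (quasiHom a d Ψ) R θ =
      quasiHom (a + b) (d + d') (mulCoeff d d' Ψ (eulerCoeff b Φ)) R θ -
      quasiHom (a + b) (d + d') (mulCoeff d d' (eulerCoeff a Ψ) Φ) R θ := by
    intro θ
    rw [rDeriv_quasiHom hΦ hR, rDeriv_quasiHom hΨ hR, mul_comm (quasiHom b d' Φ R θ),
      quasiHom_mul_quasiHom hR, quasiHom_mul_quasiHom hR]
  simp only [e]
  rw [intervalIntegral.integral_sub ((continuous_quasiHom hc1 R).intervalIntegrable _ _)
    ((continuous_quasiHom hc2 R).intervalIntegrable _ _), integral_quasiHom hc1 _ _ _ 0,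
    integral_quasiHom hc2 _ _ _ 0]
  simp only [quasiHom, mul_sub, Finset.sum_sub_distrib]

lemma hasDerivAt_dualForm_quasiHom {a b : ℤ} {d d' : ℕ} {Ψ Φ : ℕ → ℝ → ℂ}
    (hΨc : ∀ n, Continuous (Ψ n)) (hΨ : ∀ n, d < n → Ψ n = 0)
    (hΦc : ∀ n, Continuous (Φ n)) (hΦ : ∀ n, d' < n → Φ n = 0) {R : ℝ} (hR : 0 < R) :
    HasDerivAt (fun R => dualForm R (quasiHom a d Ψ) (quasiHom b d' Φ))
      ((R : ℂ)⁻¹ * ∫ θ in (0 : ℝ)..(2 * Real.pi),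
        (quasiHom a d Ψ R θ * quasiHom b d' (eulerCoeff b (eulerCoeff b Φ)) R θ -
          quasiHom b d' Φ R θ * quasiHom a d (eulerCoeff a (eulerCoeff a Ψ)) R θ)) R := by
  have hΨ' := eulerCoeff_eq_zero_of_lt (a := a) hΨ
  have hΦ' := eulerCoeff_eq_zero_of_lt (a := b) hΦ
  have hΨc' := continuous_eulerCoeff (a := a) hΨc
  have hΦc' := continuous_eulerCoeff (a := b) hΦc
  have h1 := hasDerivAt_integral_mul_quasiHom (a := a) (b := b) hΨc hΨ hΦc' hΦ' 0 (2 * Real.pi) hR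
  have h2 := hasDerivAt_integral_mul_quasiHom (a := b) (b := a) hΦc hΦ hΨc' hΨ' 0 (2 * Real.pi) hR
  have hq := @continuous_quasiHom
  refine ((h1.sub h2).congr_deriv ?_).congr_of_eventuallyEq ?_
  · rw [intervalIntegral.integral_sub, ← mul_sub]
    · congr 1
      rw [show (fun t => quasiHom b d' (eulerCoeff b Φ) R t * quasiHom a d (eulerCoeff a Ψ) R t) =
        fun t => quasiHom a d (eulerCoeff a Ψ) R t * quasiHom b d' (eulerCoeff b Φ) R t from
        funext fun t => mul_comm _ _]
      ring
    · exact ((hq hΨc R).mul (hq (continuous_eulerCoeff hΦc') R)).intervalIntegrable _ _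
    · exact ((hq hΦc R).mul (hq (continuous_eulerCoeff hΨc') R)).intervalIntegrable _ _
  · filter_upwards [lt_mem_nhds hR] with ρ hρ
    rw [dualForm_eq_integral_rDeriv, Pi.sub_apply, ← intervalIntegral.integral_sub]
    · simp only [rDeriv_quasiHom hΨ hρ, rDeriv_quasiHom hΦ hρ]
    · exact ((hq hΨc ρ).mul (hq hΦc' ρ)).intervalIntegrable _ _
    · exact ((hq hΦc ρ).mul (hq hΨc' ρ)).intervalIntegrable _ _

/-- The sum of the antisymmetric forms along an antidiagonal does not depend on the radius. -/
lemma sum_antidiagonal_dualForm_eq {ω : ℝ} {a b : ℤ}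
    {deg deg' : ℕ → ℕ} {Ψ Φ : ℕ → ℕ → ℝ → ℂ} (hΨ : IsShadowFamily ω a deg Ψ)
    (hΦ : IsShadowFamily ω b deg' Φ) (n : ℕ) {r s : ℝ} (hr : 0 < r) (hs : 0 < s) :
    ∑ x ∈ Finset.HasAntidiagonal.antidiagonal n,
        dualForm r (shadowTerm a deg Ψ x.1) (shadowTerm b deg' Φ x.2) =
      ∑ x ∈ Finset.HasAntidiagonal.antidiagonal n,
        dualForm s (shadowTerm a deg Ψ x.1) (shadowTerm b deg' Φ x.2) := by
  have key : ∀ R ∈ Set.Ioi (0 : ℝ), HasDerivAt (fun R =>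
      ∑ x ∈ Finset.HasAntidiagonal.antidiagonal n,
        dualForm R (shadowTerm a deg Ψ x.1) (shadowTerm b deg' Φ x.2)) 0 R := by
    intro R hR
    have h := HasDerivAt.fun_sum (u := Finset.HasAntidiagonal.antidiagonal n) fun x _ =>
      hasDerivAt_dualForm_quasiHom (a := a + 2 * x.1) (b := b + 2 * x.2) (hΨ.continuous x.1)
        (hΨ.eq_zero_of_lt x.1) (hΦ.continuous x.2) (hΦ.eq_zero_of_lt x.2) hR
    refine h.congr_deriv ?_
    rw [← Finset.mul_sum, ← intervalIntegral.integral_finsetSum]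
    · exact mul_eq_zero_of_right _ (integral_sum_antidiagonal_eulerCoeff hΨ hΦ n hR)
    · intro x _
      exact (((continuous_quasiHom (hΨ.continuous x.1) R).mul (continuous_quasiHom
        (continuous_eulerCoeff (continuous_eulerCoeff (hΦ.continuous x.2))) R)).sub
        ((continuous_quasiHom (hΦ.continuous x.2) R).mul (continuous_quasiHom
        (continuous_eulerCoeff (continuous_eulerCoeff (hΨ.continuous x.1))) R))).intervalIntegrable
          _ _
  exact isOpen_Ioi.is_const_of_deriv_eq_zero isPreconnected_Ioi
    (fun R hR => (key R hR).differentiableAt.differentiableWithinAt)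
    (fun R hR => (key R hR).deriv) hr hs

lemma tendsto_zpow_mul_abs_log_pow {e : ℤ} (he : 0 < e) (q : ℕ) :
    Tendsto (fun R : ℝ => R ^ e * |Real.log R| ^ q) (𝓝[>] 0) (𝓝 0) := by
  have h := (isLittleO_abs_log_rpow_rpow_nhdsGT_zero (s := -(e : ℝ)) q
    (by simpa using he)).tendsto_div_nhds_zero
  refine h.congr' ?_
  filter_upwards [self_mem_nhdsWithin] with R hR
  have hR : 0 < R := hR
  rw [Real.rpow_natCast, Real.rpow_neg hR.le, Real.rpow_intCast, div_inv_eq_mul, mul_comm]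

lemma tendsto_zpow_mul_abs_log_pow_atTop {e : ℤ} (he : e < 0) (q : ℕ) :
    Tendsto (fun R : ℝ => R ^ e * |Real.log R| ^ q) atTop (𝓝 0) := by
  have h := (tendsto_zpow_mul_abs_log_pow (neg_pos.2 he) q).comp tendsto_inv_atTop_nhdsGT_zero
  refine h.congr fun R => ?_
  simp

lemma norm_zpow_mul_log_pow {R : ℝ} (hR : 0 < R) (e : ℤ) (q : ℕ) :
    ‖(R : ℂ) ^ e * ((Real.log R : ℝ) : ℂ) ^ q‖ = R ^ e * |Real.log R| ^ q := by
  rw [norm_mul, norm_zpow, norm_pow, Complex.norm_real, Complex.norm_real, Real.norm_eq_abs,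
    Real.norm_eq_abs, abs_of_pos hR]

lemma tendsto_zpow_mul_sum_log_pow {l : Filter ℝ} (hl : ∀ᶠ R in l, 0 < R) {e : ℤ}
    (h : ∀ q : ℕ, Tendsto (fun R : ℝ => R ^ e * |Real.log R| ^ q) l (𝓝 0)) (d : ℕ) (c : ℕ → ℂ) :
    Tendsto (fun R : ℝ => (R : ℂ) ^ e *
      ∑ n ∈ Finset.range (d + 1), ((Real.log R : ℝ) : ℂ) ^ n * c n) l (𝓝 0) := by
  simp only [Finset.mul_sum]
  rw [← Finset.sum_const_zero (s := Finset.range (d + 1))]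
  refine tendsto_finsetSum _ fun n _ => ?_
  have h1 : Tendsto (fun R : ℝ => (R : ℂ) ^ e * ((Real.log R : ℝ) : ℂ) ^ n) l (𝓝 0) := by
    rw [tendsto_zero_iff_norm_tendsto_zero]
    refine (h n).congr' ?_
    filter_upwards [hl] with R hR
    exact (norm_zpow_mul_log_pow hR e n).symm
  simpa [mul_assoc] using h1.mul_const (c n)

lemma tendsto_dualForm_shadowTerm {l : Filter ℝ} (hl : ∀ᶠ R in l, 0 < R) {ω : ℝ} {a b : ℤ}
    {deg deg' : ℕ → ℕ} {Ψ Φ : ℕ → ℕ → ℝ → ℂ} (hΨ : IsShadowFamily ω a deg Ψ)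
    (hΦ : IsShadowFamily ω b deg' Φ) (j i : ℕ)
    (h : ∀ q : ℕ, Tendsto (fun R : ℝ => R ^ (a + b + 2 * (j + i)) * |Real.log R| ^ q) l (𝓝 0)) :
    Tendsto (fun R => dualForm R (shadowTerm a deg Ψ j) (shadowTerm b deg' Φ i)) l (𝓝 0) := by
  obtain ⟨c, hc⟩ := exists_dualForm_quasiHom (a := a + 2 * j) (b := b + 2 * i) (hΨ.continuous j)
    (hΨ.eq_zero_of_lt j) (hΦ.continuous i) (hΦ.eq_zero_of_lt i)
  have e : a + 2 * j + (b + 2 * i) = a + b + 2 * (j + i) := by ring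
  refine (tendsto_zpow_mul_sum_log_pow hl h (deg j + deg' i) c).congr' ?_
  filter_upwards [hl] with R hR
  rw [shadowTerm, shadowTerm, hc R hR, e]

/-- Away from homogeneity `0` the antidiagonal sums vanish. -/
lemma sum_antidiagonal_dualForm_eq_zero {ω : ℝ} {a b : ℤ}
    {deg deg' : ℕ → ℕ} {Ψ Φ : ℕ → ℕ → ℝ → ℂ} (hΨ : IsShadowFamily ω a deg Ψ)
    (hΦ : IsShadowFamily ω b deg' Φ) (n : ℕ) (hn : a + b + 2 * n ≠ 0) {R : ℝ} (hR : 0 < R) :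
    ∑ x ∈ Finset.HasAntidiagonal.antidiagonal n,
        dualForm R (shadowTerm a deg Ψ x.1) (shadowTerm b deg' Φ x.2) = 0 := by
  obtain ⟨l, hl0, hl, h⟩ : ∃ l : Filter ℝ, l.NeBot ∧ (∀ᶠ R in l, 0 < R) ∧
      ∀ q : ℕ, Tendsto (fun R : ℝ => R ^ (a + b + 2 * (n : ℤ)) * |Real.log R| ^ q) l (𝓝 0) := by
    rcases lt_or_gt_of_ne hn with hn | hn
    · exact ⟨atTop, inferInstance, eventually_gt_atTop 0, tendsto_zpow_mul_abs_log_pow_atTop hn⟩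
    · exact ⟨𝓝[>] 0, inferInstance, self_mem_nhdsWithin, tendsto_zpow_mul_abs_log_pow hn⟩
  have h1 : Tendsto (fun r => ∑ x ∈ Finset.HasAntidiagonal.antidiagonal n,
      dualForm r (shadowTerm a deg Ψ x.1) (shadowTerm b deg' Φ x.2)) l (𝓝 0) := by
    rw [← Finset.sum_const_zero (s := Finset.HasAntidiagonal.antidiagonal n)]
    refine tendsto_finsetSum _ fun x hx => tendsto_dualForm_shadowTerm hl hΨ hΦ _ _ ?_
    rwa [← Nat.cast_add, Finset.HasAntidiagonal.mem_antidiagonal.1 hx]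
  refine tendsto_nhds_unique (tendsto_const_nhds.congr' ?_) h1
  filter_upwards [hl] with r hr
  exact sum_antidiagonal_dualForm_eq hΨ hΦ n hR hr

lemma dualForm_one_quasiHom {a b : ℤ} {d d' : ℕ} {Ψ Φ : ℕ → ℝ → ℂ}
    (hΨ : ∀ n, d < n → Ψ n = 0) (hΦ : ∀ n, d' < n → Φ n = 0) :
    dualForm 1 (quasiHom a d Ψ) (quasiHom b d' Φ) = ∫ θ in (0 : ℝ)..(2 * Real.pi),
      (Ψ 0 θ * (((b : ℂ) - a) * Φ 0 θ + Φ 1 θ) - Ψ 1 θ * Φ 0 θ) := by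
  rw [dualForm_eq_integral_rDeriv]
  congr 1
  funext θ
  rw [rDeriv_quasiHom hΨ one_pos, rDeriv_quasiHom hΦ one_pos]
  simp only [quasiHom_one, eulerCoeff]
  push_cast
  ring

lemma angularCoupling_eq_sum_antidiagonal {ω ζ : ℝ} {k k' l : ℕ} (hk : k' + 2 * l = k)
    {Ψ Φ : ℕ → ℕ → ℝ → ℂ} {deg : ℕ → ℕ} (hΨ : IsShadowFamily ω (-(k : ℤ)) deg Ψ)
    (hΦ : IsShadowFamily ω k' (fun j => j) Φ) {R : ℝ} (hR : 0 < R) :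
    (Complex.I * (ζ : ℂ) ^ 2) ^ l * ∑ x ∈ Finset.HasAntidiagonal.antidiagonal l,
        dualForm R (shadowTerm (-(k : ℤ)) deg Ψ x.1) (shadowTerm k' (fun j => j) Φ x.2) =
      angularCoupling ζ k l Φ Ψ := by
  rw [angularCoupling, sum_antidiagonal_dualForm_eq hΨ hΦ l hR one_pos,
    Finset.Nat.sum_antidiagonal_eq_sum_range_succ_mk]
  congr 1
  refine Finset.sum_congr rfl fun j hj => ?_
  rw [shadowTerm, shadowTerm, dualForm_one_quasiHom (hΨ.eq_zero_of_lt _) (hΦ.eq_zero_of_lt _)]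
  congr 1
  funext θ
  have hj' : j ≤ l := Nat.lt_succ_iff.1 (Finset.mem_range.1 hj)
  rw [← hk]
  push_cast [Nat.cast_sub hj']
  ring

lemma integral_cos_nat_mul_sub_sq {k : ℕ} (hk : k ≠ 0) (φ : ℝ) :
    ∫ θ in (0 : ℝ)..(2 * Real.pi), Real.cos (k * θ - φ) ^ 2 = Real.pi := by
  have hk' : (k : ℝ) ≠ 0 := by exact_mod_cast hk
  have h : ∀ θ ∈ Set.uIcc 0 (2 * Real.pi), HasDerivAt
      (fun θ : ℝ => θ / 2 + Real.sin (2 * (k * θ - φ)) / (4 * k)) (Real.cos (k * θ - φ) ^ 2) θ := by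
    intro θ _
    have h1 : HasDerivAt (fun θ : ℝ => 2 * (k * θ - φ)) (2 * k) θ := by
      simpa using (((hasDerivAt_id θ).const_mul (k : ℝ)).sub_const φ).const_mul 2
    refine (((hasDerivAt_id θ).div_const 2).add (h1.sin.div_const (4 * (k : ℝ)))).congr_deriv ?_
    rw [Real.cos_sq]
    field_simp
    ring
  rw [intervalIntegral.integral_eq_sub_of_hasDerivAt h
    (Continuous.intervalIntegrable (by fun_prop) _ _)]
  have e : Real.sin (2 * (k * (2 * Real.pi) - φ)) = Real.sin (2 * (k * 0 - φ)) := by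
    rw [← Real.sin_add_nat_mul_two_pi (2 * (k * 0 - φ)) (2 * k)]
    congr 1
    push_cast
    ring
  rw [e]
  ring

lemma angularCoupling_zero {ω ζ : ℝ} {k : ℕ} (hk : k ≠ 0) {p : Fin 2} {Ψ Φ : ℕ → ℕ → ℝ → ℂ}
    (hΦ : IsPrimalSingularity ω k p Φ) (hΨ : IsDualSingularity ω k p Ψ) :
    angularCoupling ζ k 0 Φ Ψ = 1 := by
  have h0 : dualDegree k 0 = 0 := by
    rw [dualDegree, if_pos (Or.inr (by omega))]
  have hΦ1 : Φ 0 1 = 0 := hΦ.eq_zero_of_lt 0 1 one_pos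
  have hΨ1 : Ψ 0 1 = 0 := hΨ.eq_zero_of_lt 0 1 (by omega)
  have hk' : (k : ℝ) ≠ 0 := by exact_mod_cast hk
  have e : ∀ θ, Ψ 0 0 θ * (2 * ((k : ℂ) - 2 * ((0 : ℕ) : ℂ)) * Φ 0 0 θ + Φ 0 1 θ)
      - Ψ 0 1 θ * Φ 0 0 θ =
      ((Real.pi⁻¹ * Real.cos (k * θ - ((p : ℕ) : ℝ) * Real.pi / 2) ^ 2 : ℝ) : ℂ) := by
    intro θ
    rw [hΦ1, hΨ1, hΦ.leading_coeff, hΨ.leading_coeff hk]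
    simp only [Pi.zero_apply, zero_mul, sub_zero, add_zero]
    rw [show (2 : ℂ) * ((k : ℂ) - 2 * ((0 : ℕ) : ℂ)) = ((2 * k : ℝ) : ℂ) by push_cast; ring,
      ← Complex.ofReal_mul, ← Complex.ofReal_mul]
    congr 1
    field_simp
  rw [angularCoupling, pow_zero, one_mul, zero_add, Finset.sum_range_one]
  simp only [Nat.sub_zero, e]
  rw [intervalIntegral.integral_ofReal, intervalIntegral.integral_const_mul, integral_cos_nat_mul_sub_sq hk,
    inv_mul_cancel₀ Real.pi_ne_zero, Complex.ofReal_one]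

/-- Functions of opposite parity are orthogonal for the antisymmetric form. -/
lemma dualForm_eq_zero_of_parity {R : ℝ} (hR : 0 < R) {K A : ℝ → ℝ → ℂ} {σ : ℂ} (hσ : σ * σ = 1)
    (hK : ∀ r, 0 < r → ∀ θ, K r (-θ) = σ * K r θ)
    (hA : ∀ r, 0 < r → ∀ θ, A r (-θ) = -σ * A r θ)
    (hKp : ∀ r, Function.Periodic (K r) (2 * Real.pi))
    (hAp : ∀ r, Function.Periodic (A r) (2 * Real.pi)) : dualForm R K A = 0 := by
  set h : ℝ → ℂ := fun θ => (K R θ * deriv (fun r => A r θ) R - A R θ * deriv (fun r => K r θ) R) *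
    (R : ℂ) with hh
  have hneg : ∀ θ, h (-θ) = -h θ := by
    intro θ
    have hK' : deriv (fun r => K r (-θ)) R = σ * deriv (fun r => K r θ) R := by
      rw [← deriv_const_mul_field]
      refine EventuallyEq.deriv_eq ?_
      filter_upwards [lt_mem_nhds hR] with ρ hρ using hK ρ hρ θ
    have hA' : deriv (fun r => A r (-θ)) R = -σ * deriv (fun r => A r θ) R := by
      rw [← deriv_const_mul_field]
      refine EventuallyEq.deriv_eq ?_
      filter_upwards [lt_mem_nhds hR] with ρ hρ using hA ρ hρ θ
    simp only [hh]
    rw [hK', hA', hK R hR, hA R hR]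
    linear_combination (-(K R θ * deriv (fun r => A r θ) R -
      A R θ * deriv (fun r => K r θ) R) * (R : ℂ)) * hσ
  have hper : Function.Periodic h (2 * Real.pi) := by
    intro θ
    simp only [hh]
    rw [hKp R θ, hAp R θ]
    simp only [fun r => hKp r θ, fun r => hAp r θ]
  have h1 := hper.intervalIntegral_add_eq 0 (-(2 * Real.pi))
  rw [zero_add, neg_add_cancel] at h1
  have h2 : ∫ θ in (0 : ℝ)..(2 * Real.pi), h (-θ) = ∫ θ in (-(2 * Real.pi))..0, h θ := by
    rw [intervalIntegral.integral_comp_neg, neg_zero]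
  simp only [hneg, intervalIntegral.integral_neg] at h2
  rw [← h1] at h2
  exact self_eq_neg.1 h2.symm

/-- The remainder `R ^ (-k) R₀ ^ (2m+2) log R`. -/
def couplingRemainder (ζ : ℝ) (k m : ℕ) (R : ℝ) : ℝ :=
  R ^ (-(k : ℤ)) * cornerScale ζ R ^ (2 * m + 2) * Real.log R

lemma eventually_one_le_abs_log : ∀ᶠ R : ℝ in 𝓝[>] 0, 1 ≤ |Real.log R| := by
  have h := (Real.tendsto_log_nhdsGT_zero).eventually_le_atBot (-1)
  filter_upwards [h] with R hR
  rw [abs_of_nonpos (by linarith)]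
  linarith

lemma isBigO_couplingRemainder_of_le {ζ : ℝ} (hζ : 0 < ζ) (k m : ℕ) {q : ℕ} (hq : q ≤ m + 2) :
    (fun R : ℝ => R ^ (2 * m + 2 - k : ℤ) * |Real.log R| ^ q) =O[𝓝[>] 0]
      couplingRemainder ζ k m := by
  refine Asymptotics.IsBigO.of_bound ((ζ ^ (2 * m + 2))⁻¹) ?_
  filter_upwards [eventually_one_le_abs_log, self_mem_nhdsWithin] with R hlog hR
  have hR : 0 < R := hR
  have hM : (0 : ℝ) < ζ ^ (2 * m + 2) := by positivity
  rw [le_inv_mul_iff₀ hM]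
  have hs : |Real.log R| ^ (m + 1) ≤ (1 + √|Real.log R|) ^ (2 * m + 2) := by
    calc |Real.log R| ^ (m + 1) = √|Real.log R| ^ (2 * m + 2) := by
          rw [show 2 * m + 2 = 2 * (m + 1) by ring, pow_mul, Real.sq_sqrt (abs_nonneg _)]
      _ ≤ _ := by gcongr; linarith
  have hz : R ^ (2 * m + 2 - k : ℤ) = R ^ (-(k : ℤ)) * R ^ (2 * m + 2) := by
    rw [← zpow_natCast R (2 * m + 2), ← zpow_add₀ hR.ne']
    congr 1
    push_cast
    ring
  have hn : ‖couplingRemainder ζ k m R‖ = R ^ (-(k : ℤ)) *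
      (ζ ^ (2 * m + 2) * R ^ (2 * m + 2) * (1 + √|Real.log R|) ^ (2 * m + 2)) * |Real.log R| := by
    rw [couplingRemainder, cornerScale, Real.norm_eq_abs, abs_mul, abs_of_pos
      (by positivity : 0 < R ^ (-(k : ℤ)) * (ζ * R * (1 + √|Real.log R|)) ^ (2 * m + 2)),
      mul_pow, mul_pow]
  rw [hn, hz, Real.norm_eq_abs, abs_of_nonneg (by positivity)]
  calc ζ ^ (2 * m + 2) * (R ^ (-(k : ℤ)) * R ^ (2 * m + 2) * |Real.log R| ^ q)
      ≤ ζ ^ (2 * m + 2) * (R ^ (-(k : ℤ)) * R ^ (2 * m + 2) *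
          (|Real.log R| ^ (m + 1) * |Real.log R|)) := by
        rw [← pow_succ]
        gcongr
    _ ≤ ζ ^ (2 * m + 2) * (R ^ (-(k : ℤ)) * R ^ (2 * m + 2) *
          ((1 + √|Real.log R|) ^ (2 * m + 2) * |Real.log R|)) := by gcongr
    _ = _ := by ring

lemma isBigO_couplingRemainder_of_lt {ζ : ℝ} (hζ : 0 < ζ) {k m : ℕ} {e : ℤ}
    (he : 2 * m + 2 - k < e) (q : ℕ) :
    (fun R : ℝ => R ^ e * |Real.log R| ^ q) =O[𝓝[>] 0] couplingRemainder ζ k m := by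
  have h0 := isBigO_couplingRemainder_of_le hζ k m (q := 0) (by omega)
  have h1 := (tendsto_zpow_mul_abs_log_pow (sub_pos.2 he) q).isBigO_one ℝ
  refine (h1.mul h0).congr' ?_ ?_
  · filter_upwards [self_mem_nhdsWithin] with R hR
    have hR : 0 < R := hR
    have : R ^ e = R ^ (e - (2 * m + 2 - k)) * R ^ (2 * m + 2 - k : ℤ) := by
      rw [← zpow_add₀ hR.ne', sub_add_cancel]
    rw [this]
    ring
  · simp

lemma tendsto_couplingRemainder {ζ : ℝ} {k m : ℕ} (hm : k < 2 * m + 2) :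
    Tendsto (couplingRemainder ζ k m) (𝓝[>] 0) (𝓝 0) := by
  have h : Tendsto (fun R : ℝ => |ζ| ^ (2 * m + 2) * 2 ^ (2 * m + 2) *
      (R ^ (2 * m + 2 - k : ℤ) * |Real.log R| ^ (2 * m + 3))) (𝓝[>] 0) (𝓝 0) := by
    simpa using (tendsto_zpow_mul_abs_log_pow (e := 2 * m + 2 - k) (by omega)
      (2 * m + 3)).const_mul (|ζ| ^ (2 * m + 2) * 2 ^ (2 * m + 2))
  refine squeeze_zero_norm' ?_ h
  filter_upwards [eventually_one_le_abs_log, self_mem_nhdsWithin] with R hlog hR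
  have hR : 0 < R := hR
  have hz : R ^ (2 * m + 2 - k : ℤ) = R ^ (-(k : ℤ)) * R ^ (2 * m + 2) := by
    rw [← zpow_natCast R (2 * m + 2), ← zpow_add₀ hR.ne']
    congr 1
    push_cast
    ring
  have hs : 1 + √|Real.log R| ≤ 2 * |Real.log R| := by
    have : √|Real.log R| ≤ |Real.log R| := by
      rw [Real.sqrt_le_left (abs_nonneg _)]
      nlinarith
    linarith
  rw [couplingRemainder, cornerScale, Real.norm_eq_abs, abs_mul, abs_mul, abs_pow, abs_mul, abs_mul,
    abs_of_pos (zpow_pos hR _), abs_of_pos hR,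
    abs_of_nonneg (by positivity : 0 ≤ 1 + √|Real.log R|), hz]
  calc R ^ (-(k : ℤ)) * (|ζ| * R * (1 + √|Real.log R|)) ^ (2 * m + 2) * |Real.log R|
      ≤ R ^ (-(k : ℤ)) * (|ζ| * R * (2 * |Real.log R|)) ^ (2 * m + 2) * |Real.log R| := by gcongr
    _ = _ := by ring

lemma dualDegree_le (k j : ℕ) : dualDegree k j ≤ j + 1 := by
  unfold dualDegree
  split_ifs <;> omega

lemma isBigO_dualForm_shadowTerm {ω ζ : ℝ} (hζ : 0 < ζ) {k k' m : ℕ} {Ψ Φ : ℕ → ℕ → ℝ → ℂ}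
    (hΨ : IsShadowFamily ω (-(k : ℤ)) (dualDegree k) Ψ)
    (hΦ : IsShadowFamily ω k' (fun j => j) Φ) {j i : ℕ} (h : 2 * m + 2 ≤ k' + 2 * (j + i)) :
    (fun R => dualForm R (shadowTerm (-(k : ℤ)) (dualDegree k) Ψ j)
      (shadowTerm k' (fun j => j) Φ i)) =O[𝓝[>] 0] couplingRemainder ζ k m := by
  obtain ⟨c, hc⟩ := exists_dualForm_quasiHom (a := -(k : ℤ) + 2 * j) (b := k' + 2 * i)
    (hΨ.continuous j) (hΨ.eq_zero_of_lt j) (hΦ.continuous i) (hΦ.eq_zero_of_lt i)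
  have key : (fun R : ℝ => ∑ n ∈ Finset.range (dualDegree k j + i + 1),
      ((R : ℂ) ^ (-(k : ℤ) + 2 * j + (k' + 2 * i)) * ((Real.log R : ℝ) : ℂ) ^ n) * c n)
        =O[𝓝[>] 0] couplingRemainder ζ k m := by
    refine Asymptotics.IsBigO.fun_sum fun n hn => ?_
    have hb : (fun R : ℝ => R ^ (-(k : ℤ) + 2 * j + (k' + 2 * i)) * |Real.log R| ^ n)
        =O[𝓝[>] 0] couplingRemainder ζ k m := by
      rcases h.lt_or_eq with h | h
      · exact isBigO_couplingRemainder_of_lt hζ (by omega) n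
      · rw [show (-(k : ℤ) + 2 * j + (k' + 2 * i)) = 2 * m + 2 - k by omega]
        have := dualDegree_le k j
        have := Finset.mem_range.1 hn
        exact isBigO_couplingRemainder_of_le hζ k m (by omega)
    have hb' : (fun R : ℝ => (R : ℂ) ^ (-(k : ℤ) + 2 * j + (k' + 2 * i)) *
        ((Real.log R : ℝ) : ℂ) ^ n) =O[𝓝[>] 0] couplingRemainder ζ k m := by
      refine Asymptotics.IsBigO.trans (Asymptotics.IsBigO.of_bound 1 ?_) hb
      filter_upwards [self_mem_nhdsWithin] with R hR
      rw [norm_zpow_mul_log_pow hR, one_mul]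
      exact le_abs_self _
    simpa [mul_comm] using hb'.const_mul_left (c n)
  refine key.congr' ?_ EventuallyEq.rfl
  filter_upwards [self_mem_nhdsWithin] with R hR
  rw [shadowTerm, shadowTerm, hc R hR, Finset.mul_sum]
  exact Finset.sum_congr rfl fun n _ => by ring

lemma sum_range_sum_range_eq (f : ℕ → ℕ → ℂ) {m M L : ℕ} (hm : L ≤ m + 1) (hM : L ≤ M + 1) :
    ∑ j ∈ Finset.range (m + 1), ∑ i ∈ Finset.range (M + 1), f j i =
      ∑ n ∈ Finset.range L, ∑ x ∈ Finset.HasAntidiagonal.antidiagonal n, f x.1 x.2 +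
        ∑ j ∈ Finset.range (m + 1), ∑ i ∈ Finset.range (M + 1), if j + i < L then 0 else f j i := by
  have h1 : ∑ n ∈ Finset.range L, ∑ x ∈ Finset.HasAntidiagonal.antidiagonal n, f x.1 x.2 =
      ∑ j ∈ Finset.range (m + 1), ∑ i ∈ Finset.range (M + 1), if j + i < L then f j i else 0 := by
    rw [← Finset.sum_product', ← Finset.sum_filter, ← Finset.sum_fiberwise_of_maps_to
      (t := Finset.range L) (g := fun x : ℕ × ℕ => x.1 + x.2)
      (fun x hx => Finset.mem_range.2 (Finset.mem_filter.1 hx).2)]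
    refine Finset.sum_congr rfl fun n hn => Finset.sum_congr ?_ fun _ _ => rfl
    have hn := Finset.mem_range.1 hn
    ext x
    simp only [Finset.HasAntidiagonal.mem_antidiagonal, Finset.mem_filter, Finset.mem_product,
      Finset.mem_range]
    omega
  rw [h1, ← Finset.sum_add_distrib]
  refine Finset.sum_congr rfl fun j _ => ?_
  rw [← Finset.sum_add_distrib]
  refine Finset.sum_congr rfl fun i _ => ?_
  split_ifs <;> simp

lemma isRadiallyRegular_shadowTerm {ω : ℝ} {a : ℤ} {deg : ℕ → ℕ} {Φ : ℕ → ℕ → ℝ → ℂ}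
    (h : IsShadowFamily ω a deg Φ) (j : ℕ) {R : ℝ} (hR : 0 < R) :
    IsRadiallyRegular R (shadowTerm a deg Φ j) :=
  isRadiallyRegular_quasiHom (h.continuous j) (h.eq_zero_of_lt j) hR

lemma isRadiallyRegular_dualTrunc {ω ζ : ℝ} {k : ℕ} {Ψ : ℕ → ℕ → ℝ → ℂ}
    (h : IsShadowFamily ω (-(k : ℤ)) (dualDegree k) Ψ) (m : ℕ) {R : ℝ} (hR : 0 < R) :
    IsRadiallyRegular R (dualTrunc ζ k Ψ m) :=
  IsRadiallyRegular.sum fun j _ => (isRadiallyRegular_shadowTerm h j hR).const_mul _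

lemma isRadiallyRegular_primalTrunc {ω ζ : ℝ} {k : ℕ} {Φ : ℕ → ℕ → ℝ → ℂ}
    (h : IsShadowFamily ω k (fun j => j) Φ) (m : ℕ) {R : ℝ} (hR : 0 < R) :
    IsRadiallyRegular R (primalTrunc ζ k Φ m) :=
  IsRadiallyRegular.sum fun j _ => (isRadiallyRegular_shadowTerm h j hR).const_mul _

/-- The antisymmetric form of two truncated series: full antidiagonals give the coupling
coefficients, the incomplete ones are left as a remainder. -/
lemma dualForm_dualTrunc_primalTrunc {ω ζ : ℝ} {k k' m M L : ℕ} {Ψ Φ : ℕ → ℕ → ℝ → ℂ}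
    (hΨ : IsShadowFamily ω (-(k : ℤ)) (dualDegree k) Ψ)
    (hΦ : IsShadowFamily ω k' (fun j => j) Φ) (hm : L ≤ m + 1) (hM : L ≤ M + 1) {R : ℝ}
    (hR : 0 < R) :
    dualForm R (dualTrunc ζ k Ψ m) (primalTrunc ζ k' Φ M) =
      ∑ n ∈ Finset.range L, (if k' + 2 * n = k then angularCoupling ζ k n Φ Ψ else 0) +
        ∑ j ∈ Finset.range (m + 1), ∑ i ∈ Finset.range (M + 1),
          if j + i < L then 0 else (Complex.I * (ζ : ℂ) ^ 2) ^ (j + i) *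
            dualForm R (shadowTerm (-(k : ℤ)) (dualDegree k) Ψ j)
              (shadowTerm k' (fun j => j) Φ i) := by
  have h := dualForm_sum_const_mul (s := Finset.range (m + 1)) (t := Finset.range (M + 1))
    (fun j => isRadiallyRegular_shadowTerm hΨ j hR) (fun i => isRadiallyRegular_shadowTerm hΦ i hR)
    (Complex.I * (ζ : ℂ) ^ 2)
  refine h.trans ?_
  rw [sum_range_sum_range_eq _ hm hM]
  congr 1
  refine Finset.sum_congr rfl fun n _ => ?_
  have e : ∑ x ∈ Finset.HasAntidiagonal.antidiagonal n, (Complex.I * (ζ : ℂ) ^ 2) ^ (x.1 + x.2) *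
      dualForm R (shadowTerm (-(k : ℤ)) (dualDegree k) Ψ x.1) (shadowTerm k' (fun j => j) Φ x.2) =
      (Complex.I * (ζ : ℂ) ^ 2) ^ n * ∑ x ∈ Finset.HasAntidiagonal.antidiagonal n,
      dualForm R (shadowTerm (-(k : ℤ)) (dualDegree k) Ψ x.1)
        (shadowTerm k' (fun j => j) Φ x.2) := by
    rw [Finset.mul_sum]
    refine Finset.sum_congr rfl fun x hx => ?_
    rw [Finset.HasAntidiagonal.mem_antidiagonal.1 hx]
  rw [e]
  split_ifs with hk
  · exact angularCoupling_eq_sum_antidiagonal hk hΨ hΦ hR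
  · rw [sum_antidiagonal_dualForm_eq_zero hΨ hΦ n (by omega) hR, mul_zero]

lemma tendsto_dualForm_dualTrunc_primalTrunc {ω ζ : ℝ} {k l m m' : ℕ} {Ψ Φ : ℕ → ℕ → ℝ → ℂ}
    (hΨ : IsShadowFamily ω (-(k : ℤ)) (dualDegree k) Ψ) (hl : 2 * l ≤ k)
    (hΦ : IsShadowFamily ω (k - 2 * l : ℕ) (fun j => j) Φ) (hk : k < 2 * m + 2) (hm : m ≤ m') :
    Tendsto (fun R => dualForm R (dualTrunc ζ k Ψ m) (primalTrunc ζ (k - 2 * l) Φ m')) (𝓝[>] 0)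
      (𝓝 (angularCoupling ζ k l Φ Ψ)) := by
  have hs : ∑ n ∈ Finset.range (m + 1),
      (if k - 2 * l + 2 * n = k then angularCoupling ζ k n Φ Ψ else 0) =
      angularCoupling ζ k l Φ Ψ := by
    rw [Finset.sum_eq_single l]
    · rw [if_pos (by omega)]
    · intro n _ hn
      rw [if_neg (by omega)]
    · intro h
      exact absurd (Finset.mem_range.2 (by omega)) h
  rw [← add_zero (angularCoupling ζ k l Φ Ψ)]
  have hrem : Tendsto (fun R => ∑ j ∈ Finset.range (m + 1), ∑ i ∈ Finset.range (m' + 1),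
      if j + i < m + 1 then 0 else (Complex.I * (ζ : ℂ) ^ 2) ^ (j + i) *
        dualForm R (shadowTerm (-(k : ℤ)) (dualDegree k) Ψ j)
          (shadowTerm (k - 2 * l : ℕ) (fun j => j) Φ i)) (𝓝[>] 0) (𝓝 0) := by
    have h0 : ∑ _j ∈ Finset.range (m + 1), ∑ _i ∈ Finset.range (m' + 1), (0 : ℂ) = 0 := by simp
    refine (tendsto_finsetSum (a := fun _ => ∑ _i ∈ Finset.range (m' + 1), (0 : ℂ)) _ fun j _ =>
      tendsto_finsetSum (a := fun _ => (0 : ℂ)) _ fun i _ => ?_).mono_right (by rw [h0])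
    split_ifs with h
    · exact tendsto_const_nhds
    · rw [← mul_zero ((Complex.I * (ζ : ℂ) ^ 2) ^ (j + i))]
      exact (tendsto_dualForm_shadowTerm self_mem_nhdsWithin hΨ hΦ j i
        (tendsto_zpow_mul_abs_log_pow (by push_cast [Nat.cast_sub hl]; omega))).const_mul _
  refine (tendsto_const_nhds.add hrem).congr' ?_
  filter_upwards [self_mem_nhdsWithin] with R hR
  rw [dualForm_dualTrunc_primalTrunc hΨ hΦ le_rfl (by omega) hR, hs]

/-- A continuous quasi-homogeneous function of degree `a` is `o(r ^ (a - 1/2))`, uniformly in the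
angle. -/
lemma eventually_sqrt_mul_norm_quasiHom_le {a : ℤ} {d : ℕ} {Φ : ℕ → ℝ → ℂ}
    (hc : ∀ n, Continuous (Φ n)) (hp : ∀ n, Function.Periodic (Φ n) (2 * Real.pi)) {ε : ℝ}
    (hε : 0 < ε) : ∀ᶠ r in 𝓝[>] (0 : ℝ), ∀ θ, √r * ‖quasiHom a d Φ r θ‖ ≤ ε * r ^ a := by
  have hb : ∀ n, ∃ C : ℝ, ∀ θ, ‖Φ n θ‖ ≤ C := by
    intro n
    obtain ⟨C, hC⟩ := ((hp n).isBounded_of_continuous Real.two_pi_pos.ne' (hc n)).exists_norm_le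
    exact ⟨C, fun θ => hC _ ⟨θ, rfl⟩⟩
  choose C hC using hb
  have hlim : Tendsto (fun r : ℝ => ∑ n ∈ Finset.range (d + 1), √r * |Real.log r| ^ n * C n)
      (𝓝[>] 0) (𝓝 0) := by
    rw [← Finset.sum_const_zero (s := Finset.range (d + 1))]
    refine tendsto_finsetSum _ fun n _ => ?_
    have h := (isLittleO_abs_log_rpow_rpow_nhdsGT_zero (s := -(1 / 2)) n
      (by norm_num)).tendsto_div_nhds_zero
    have h' : Tendsto (fun r : ℝ => √r * |Real.log r| ^ n) (𝓝[>] 0) (𝓝 0) := by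
      refine h.congr' ?_
      filter_upwards [self_mem_nhdsWithin] with R hR
      have hR : 0 < R := hR
      rw [Real.rpow_natCast, Real.rpow_neg hR.le, div_inv_eq_mul, mul_comm, Real.sqrt_eq_rpow]
    simpa using h'.mul_const (C n)
  filter_upwards [hlim.eventually_le_const hε, self_mem_nhdsWithin] with r hr hr0 θ
  have hr0 : 0 < r := hr0
  have h1 : ‖quasiHom a d Φ r θ‖ ≤
      r ^ a * ∑ n ∈ Finset.range (d + 1), |Real.log r| ^ n * C n := by
    rw [quasiHom, norm_mul, norm_zpow, Complex.norm_real, Real.norm_eq_abs, abs_of_pos hr0]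
    gcongr
    refine (norm_sum_le _ _).trans (Finset.sum_le_sum fun n _ => ?_)
    rw [norm_mul, norm_pow, Complex.norm_real, Real.norm_eq_abs]
    gcongr
    exact hC n θ
  calc √r * ‖quasiHom a d Φ r θ‖
      ≤ √r * (r ^ a * ∑ n ∈ Finset.range (d + 1), |Real.log r| ^ n * C n) := by gcongr
    _ = r ^ a * ∑ n ∈ Finset.range (d + 1), √r * |Real.log r| ^ n * C n := by
      simp only [Finset.mul_sum]
      exact Finset.sum_congr rfl fun n _ => by ring
    _ ≤ r ^ a * ε := by gcongr
    _ = ε * r ^ a := mul_comm _ _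

lemma HasCornerExpansion.exists_isRadiallyRegular {ζ : ℝ} {Φ : ℕ → Fin 2 → ℕ → ℕ → ℝ → ℂ}
    {A : ℝ → ℝ → ℂ} {Λ : ℕ → Fin 2 → ℂ} (h : HasCornerExpansion ζ Φ A Λ) :
    ∃ R₁ : ℝ, 0 < R₁ ∧ ∀ R ∈ Set.Ioo 0 R₁, IsRadiallyRegular R A := by
  obtain ⟨R₁, hR₁, hA⟩ := h.regular
  refine ⟨R₁, hR₁, fun R hR => ?_⟩
  have hopen : IsOpen (Set.Ioo 0 R₁ ×ˢ (Set.univ : Set ℝ)) := isOpen_Ioo.prod isOpen_univ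
  have hmem : ∀ θ : ℝ, (R, θ) ∈ Set.Ioo 0 R₁ ×ˢ (Set.univ : Set ℝ) := fun θ => ⟨hR, trivial⟩
  have hd : ∀ θ : ℝ, HasDerivAt (fun r => A r θ)
      (fderiv ℝ (fun x : ℝ × ℝ => A x.1 x.2) (R, θ) (1, 0)) R := by
    intro θ
    have h1 := ((hA.contDiffAt (hopen.mem_nhds (hmem θ))).differentiableAt one_ne_zero).hasFDerivAt
    have h2 : HasDerivAt (fun r : ℝ => (r, θ)) ((1 : ℝ), (0 : ℝ)) R :=
      (hasDerivAt_id R).prodMk (hasDerivAt_const R θ)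
    exact h1.comp_hasDerivAt R h2
  refine ⟨fun θ => (hd θ).differentiableAt, ?_, ?_⟩
  · exact hA.continuousOn.comp_continuous (Continuous.prodMk_right R) hmem
  · have h1 := (hA.continuousOn_fderiv_of_isOpen hopen le_rfl).comp_continuous
      (Continuous.prodMk_right R) hmem
    have h2 : rDeriv A R =
        fun θ => (R : ℂ) * fderiv ℝ (fun x : ℝ × ℝ => A x.1 x.2) (R, θ) (1, 0) :=
      funext fun θ => by rw [rDeriv, (hd θ).deriv]
    rw [h2]
    exact continuous_const.mul (h1.clm_apply continuous_const)

lemma eventually_norm_quasiHom_le {a b : ℤ} (hab : b < a) {d : ℕ} {Φ : ℕ → ℝ → ℂ}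
    (hc : ∀ n, Continuous (Φ n)) (hp : ∀ n, Function.Periodic (Φ n) (2 * Real.pi)) :
    ∀ᶠ r in 𝓝[>] (0 : ℝ), ∀ θ, ‖quasiHom a d Φ r θ‖ ≤ r ^ b := by
  filter_upwards [eventually_sqrt_mul_norm_quasiHom_le (a := a) (d := d) hc hp one_pos,
    Ioo_mem_nhdsGT one_pos] with r hr hr1 θ
  have h1 : r ≤ √r := by
    apply Real.le_sqrt_of_sq_le
    nlinarith [hr1.1, hr1.2]
  have h2 : r * ‖quasiHom a d Φ r θ‖ ≤ r * r ^ b := by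
    calc r * ‖quasiHom a d Φ r θ‖ ≤ √r * ‖quasiHom a d Φ r θ‖ := by gcongr
      _ ≤ r ^ a := by simpa using hr θ
      _ ≤ r ^ (1 + b) := zpow_le_zpow_right_of_le_one₀ hr1.1 hr1.2.le (by omega)
      _ = r * r ^ b := by rw [zpow_one_add₀ hr1.1.ne']
  exact le_of_mul_le_mul_left h2 hr1.1

lemma exists_norm_dualTrunc_le {ω ζ : ℝ} {k : ℕ} {Ψ : ℕ → ℕ → ℝ → ℂ}
    (h : IsShadowFamily ω (-(k : ℤ)) (dualDegree k) Ψ) (m : ℕ) :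
    ∃ C : ℝ, ∀ᶠ R in 𝓝[>] (0 : ℝ), ∀ θ, ‖dualTrunc ζ k Ψ m R θ‖ ≤ C * R ^ (-(k : ℤ) - 1) ∧
      ‖rDeriv (dualTrunc ζ k Ψ m) R θ‖ ≤ C * R ^ (-(k : ℤ) - 1) := by
  refine ⟨∑ j ∈ Finset.range (m + 1), ‖(Complex.I * (ζ : ℂ) ^ 2) ^ j‖, ?_⟩
  have h1 : ∀ j, ∀ᶠ R in 𝓝[>] (0 : ℝ), ∀ θ,
      ‖shadowTerm (-(k : ℤ)) (dualDegree k) Ψ j R θ‖ ≤ R ^ (-(k : ℤ) - 1) := fun j =>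
    eventually_norm_quasiHom_le (by omega) (h.continuous j) fun n => (h.angular j n).periodic
  have h2 : ∀ j : ℕ, ∀ᶠ R in 𝓝[>] (0 : ℝ), ∀ θ,
      ‖quasiHom (-(k : ℤ) + 2 * j) (dualDegree k j) (eulerCoeff (-(k : ℤ) + 2 * j) (Ψ j)) R θ‖ ≤
        R ^ (-(k : ℤ) - 1) := fun j =>
    eventually_norm_quasiHom_le (by omega) (continuous_eulerCoeff (h.continuous j))
      (IsAngular.periodic_eulerCoeff (h.angular j))
  filter_upwards [self_mem_nhdsWithin,
    (Filter.eventually_all_finset (Finset.range (m + 1))).2 fun j _ => h1 j,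
    (Filter.eventually_all_finset (Finset.range (m + 1))).2 fun j _ => h2 j] with R hR h1 h2 θ
  have hR : 0 < R := hR
  rw [Finset.sum_mul]
  constructor
  · refine (norm_sum_le _ _).trans (Finset.sum_le_sum fun j hj => ?_)
    rw [norm_mul]
    gcongr
    exact h1 j hj θ
  · have e : rDeriv (dualTrunc ζ k Ψ m) R θ = ∑ j ∈ Finset.range (m + 1),
        (Complex.I * (ζ : ℂ) ^ 2) ^ j * quasiHom (-(k : ℤ) + 2 * j) (dualDegree k j)
          (eulerCoeff (-(k : ℤ) + 2 * j) (Ψ j)) R θ := by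
      refine (rDeriv_fun_sum fun j _ =>
        ((isRadiallyRegular_shadowTerm h j hR).const_mul _).differentiableAt θ).trans ?_
      refine Finset.sum_congr rfl fun j _ => ?_
      rw [← rDeriv_quasiHom (h.eq_zero_of_lt j) hR]
      exact rDeriv_const_mul _ ((isRadiallyRegular_shadowTerm h j hR).differentiableAt θ)
    rw [e]
    refine (norm_sum_le _ _).trans (Finset.sum_le_sum fun j hj => ?_)
    rw [norm_mul]
    gcongr
    exact h2 j hj θ

lemma dualForm_dualTrunc_primalTrunc_of_ne {ω ζ : ℝ} {k k' : ℕ} {p p' : Fin 2} (hp : p' ≠ p)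
    {Ψ Φ : ℕ → ℕ → ℝ → ℂ} (hΨ : IsDualSingularity ω k p Ψ) (hΦ : IsPrimalSingularity ω k' p' Φ)
    (m M : ℕ) {R : ℝ} (hR : 0 < R) :
    dualForm R (dualTrunc ζ k Ψ m) (primalTrunc ζ k' Φ M) = 0 := by
  have hσ : (-1 : ℂ) ^ (p' : ℕ) = -(-1) ^ (p : ℕ) := by
    fin_cases p <;> fin_cases p' <;> simp at hp ⊢
  refine dualForm_eq_zero_of_parity hR (σ := (-1) ^ (p : ℕ)) ?_ ?_ ?_ ?_ ?_
  · rw [← mul_pow]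
    norm_num
  · intro r hr θ
    simp only [dualTrunc, hΨ.parity _ r hr θ, Finset.mul_sum]
    exact Finset.sum_congr rfl fun j _ => by ring
  · intro r hr θ
    simp only [primalTrunc, hΦ.parity _ r hr θ, Finset.mul_sum, hσ]
    exact Finset.sum_congr rfl fun j _ => by ring
  · intro r θ
    refine Finset.sum_congr rfl fun j _ => ?_
    rw [dualTerm, periodic_quasiHom (fun n => (hΨ.angular j n).periodic) r θ]
    rfl
  · intro r θ
    refine Finset.sum_congr rfl fun j _ => ?_
    rw [primalTerm, periodic_quasiHom (fun n => (hΦ.angular j n).periodic) r θ]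
    rfl

lemma dualForm_cornerPartialSum {ω ζ : ℝ} {Φ : ℕ → Fin 2 → ℕ → ℕ → ℝ → ℂ}
    (hΦ : ∀ k p, IsPrimalSingularity ω k p (Φ k p)) {k : ℕ} (hk : k ≠ 0) {p : Fin 2}
    {Ψ : ℕ → ℕ → ℝ → ℂ} (hΨ : IsDualSingularity ω k p Ψ) (m N : ℕ) (Λ : ℕ → Fin 2 → ℂ) {R : ℝ}
    (hR : 0 < R) :
    dualForm R (dualTrunc ζ k Ψ m) (cornerPartialSum ζ Φ Λ N) =
      ∑ k' ∈ Finset.range (N + 1),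
        Λ k' p * dualForm R (dualTrunc ζ k Ψ m) (primalTrunc ζ k' (Φ k' p) ((N - k') / 2)) := by
  have hK : IsRadiallyRegular R (dualTrunc ζ k Ψ m) :=
    isRadiallyRegular_dualTrunc (hΨ.isShadowFamily hk) m hR
  have hS : ∀ k' p', IsRadiallyRegular R (primalTrunc ζ k' (Φ k' p') ((N - k') / 2)) :=
    fun k' p' => isRadiallyRegular_primalTrunc (hΦ k' p').isShadowFamily _ hR
  refine (dualForm_sum_right hK fun k' _ =>
    IsRadiallyRegular.sum fun p' _ => (hS k' p').const_mul _).trans ?_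
  refine Finset.sum_congr rfl fun k' _ => ?_
  rw [dualForm_sum_right hK fun p' _ => (hS k' p').const_mul _, Finset.sum_eq_single p]
  · exact dualForm_const_mul_right _ (hS k' p) _
  · intro p' _ hp'
    rw [dualForm_const_mul_right _ (hS k' p'),
      dualForm_dualTrunc_primalTrunc_of_ne hp' hΨ (hΦ k' p') _ _ hR, mul_zero]
  · simp

lemma sum_coupling_eq (k m : ℕ) (hm : k < 2 * m + 2) (Λ : ℕ → ℂ) (c : ℕ → ℕ → ℂ)
    (h0 : c k 0 = 1) :
    ∑ k' ∈ Finset.range (2 * m + 3 + 1), Λ k' * ∑ n ∈ Finset.range ((2 * m + 3 - k') / 2),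
      (if k' + 2 * n = k then c k' n else 0) =
      Λ k + ∑ l ∈ Finset.Icc 1 (k / 2), c (k - 2 * l) l * Λ (k - 2 * l) := by
  have h1 : ∀ k', ∑ n ∈ Finset.range ((2 * m + 3 - k') / 2),
      (if k' + 2 * n = k then c k' n else 0) =
      ∑ n ∈ Finset.range (k / 2 + 1), (if k' + 2 * n = k then c k' n else 0) := by
    intro k'
    rw [← Finset.sum_filter, ← Finset.sum_filter]
    refine Finset.sum_congr ?_ fun _ _ => rfl
    ext n
    simp only [Finset.mem_filter, Finset.mem_range]
    omega
  simp only [h1, Finset.mul_sum]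
  rw [Finset.sum_comm]
  have h2 : ∀ n ∈ Finset.range (k / 2 + 1), ∑ k' ∈ Finset.range (2 * m + 3 + 1),
      Λ k' * (if k' + 2 * n = k then c k' n else 0) = c (k - 2 * n) n * Λ (k - 2 * n) := by
    intro n hn
    have hn := Finset.mem_range.1 hn
    rw [Finset.sum_eq_single (k - 2 * n)]
    · rw [if_pos (by omega), mul_comm]
    · intro k' _ hk'
      rw [if_neg (by omega), mul_zero]
    · intro h
      exact absurd (Finset.mem_range.2 (by omega)) h
  rw [Finset.sum_congr rfl h2, Finset.sum_range_succ', mul_zero, Nat.sub_zero, h0, one_mul,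
    add_comm]
  congr 1
  rw [show Finset.Icc 1 (k / 2) = Finset.Ico 1 (k / 2 + 1) from by ext; simp,
    Finset.sum_Ico_eq_sum_range, add_tsub_cancel_right]
  simp only [add_comm]

theorem isCouplingFamily_angularCoupling {ω ζ : ℝ} (hζ : 0 < ζ)
    {Φ : ℕ → Fin 2 → ℕ → ℕ → ℝ → ℂ} (hΦ : ∀ k p, IsPrimalSingularity ω k p (Φ k p))
    {k : ℕ} (hk : k ≠ 0) {p : Fin 2} {Ψ : ℕ → ℕ → ℝ → ℂ} (hΨ : IsDualSingularity ω k p Ψ)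
    {m : ℕ} (hm : k < 2 * m + 2) :
    IsCouplingFamily ζ Φ k p Ψ m fun l => angularCoupling ζ k l (Φ (k - 2 * l) p) Ψ := by
  intro A Λ hA
  change _ =O[_] couplingRemainder ζ k m
  have hΨ' := hΨ.isShadowFamily hk
  have hΦ' := fun k p => (hΦ k p).isShadowFamily
  obtain ⟨R₁, hR₁, hreg⟩ := hA.exists_isRadiallyRegular
  set N := 2 * m + 3 with hN
  have hrest : (fun R => dualForm R (dualTrunc ζ k Ψ m)
      (fun r θ => A r θ - cornerPartialSum ζ Φ Λ N r θ)) =O[𝓝[>] 0] couplingRemainder ζ k m := by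
    obtain ⟨C, hC⟩ := exists_norm_dualTrunc_le (ζ := ζ) hΨ' m
    refine Asymptotics.IsBigO.trans (Asymptotics.IsBigO.of_bound (4 * Real.pi * C) ?_)
      (isBigO_couplingRemainder_of_le hζ k m (Nat.zero_le _))
    filter_upwards [hC, hA.expansion N 1 one_pos, self_mem_nhdsWithin] with R hC hD hR
    have hR : 0 < R := hR
    refine (norm_dualForm_le (fun θ => (hC θ).1) (fun θ => (hC θ).2) (fun θ => (hD θ).1)
      (fun θ => (hD θ).2)).trans (le_of_eq ?_)
    have hz : R ^ (2 * m + 2 - k : ℤ) = R ^ (-(k : ℤ) - 1) * R ^ N := by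
      rw [← zpow_natCast R N, ← zpow_add₀ hR.ne']
      congr 1
      rw [hN]
      push_cast
      ring
    rw [pow_zero, mul_one, hz, Real.norm_eq_abs, abs_of_pos (by positivity)]
    ring
  have hpart : (fun R => ∑ k' ∈ Finset.range (N + 1), Λ k' p *
      ∑ j ∈ Finset.range (m + 1), ∑ i ∈ Finset.range ((N - k') / 2 + 1),
        if j + i < (N - k') / 2 then 0 else (Complex.I * (ζ : ℂ) ^ 2) ^ (j + i) *
          dualForm R (shadowTerm (-(k : ℤ)) (dualDegree k) Ψ j)
            (shadowTerm k' (fun j => j) (Φ k' p) i)) =O[𝓝[>] 0] couplingRemainder ζ k m := by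
    refine Asymptotics.IsBigO.fun_sum fun k' hk' => Asymptotics.IsBigO.const_mul_left ?_ _
    refine Asymptotics.IsBigO.fun_sum fun j _ => Asymptotics.IsBigO.fun_sum fun i _ => ?_
    split_ifs with h
    · exact Asymptotics.isBigO_zero _ _
    · have := Finset.mem_range.1 hk'
      exact (isBigO_dualForm_shadowTerm hζ hΨ' (hΦ' k' p) (by omega)).const_mul_left _
  refine (hrest.add hpart).congr' ?_ EventuallyEq.rfl
  filter_upwards [Ioo_mem_nhdsGT hR₁] with R hR
  have hK : IsRadiallyRegular R (dualTrunc ζ k Ψ m) := isRadiallyRegular_dualTrunc hΨ' m hR.1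
  have hP : IsRadiallyRegular R (cornerPartialSum ζ Φ Λ N) :=
    IsRadiallyRegular.sum fun k' _ => IsRadiallyRegular.sum fun p' _ =>
      (isRadiallyRegular_primalTrunc (hΦ' k' p') _ hR.1).const_mul _
  have hsum := sum_coupling_eq k m hm (fun k' => Λ k' p)
    (fun k' n => angularCoupling ζ k n (Φ k' p) Ψ) (angularCoupling_zero hk (hΦ k p) hΨ)
  rw [dualForm_sub_right hK (hreg R hR) hP, dualForm_cornerPartialSum hΦ hk hΨ m N Λ hR.1, ← hsum]
  have e : ∀ k' ∈ Finset.range (N + 1), Λ k' p *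
      dualForm R (dualTrunc ζ k Ψ m) (primalTrunc ζ k' (Φ k' p) ((N - k') / 2)) = _ := fun k' _ => by
    rw [dualForm_dualTrunc_primalTrunc (L := (N - k') / 2) hΨ' (hΦ' k' p) (by omega) (by omega)
      hR.1, mul_add]
  rw [Finset.sum_congr rfl e, Finset.sum_add_distrib]
  ring

/-- A smooth cutoff equal to `1` on `(-∞, 1]` and to `0` on `[2, ∞)`. -/
def radialCutoff (x : ℝ) : ℝ := Real.smoothTransition (2 - x)

lemma contDiff_radialCutoff : ContDiff ℝ 1 radialCutoff :=
  Real.smoothTransition.contDiff.comp (contDiff_const.sub contDiff_id)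

lemma radialCutoff_of_le {x : ℝ} (hx : x ≤ 1) : radialCutoff x = 1 :=
  Real.smoothTransition.one_of_one_le (by linarith)

lemma radialCutoff_of_ge {x : ℝ} (hx : 2 ≤ x) : radialCutoff x = 0 :=
  Real.smoothTransition.zero_of_nonpos (by linarith)

lemma abs_radialCutoff_le (x : ℝ) : |radialCutoff x| ≤ 1 := by
  rw [radialCutoff, abs_of_nonneg (Real.smoothTransition.nonneg _)]
  exact Real.smoothTransition.le_one _

lemma exists_abs_mul_deriv_radialCutoff_le : ∃ B : ℝ, ∀ x, |x * deriv radialCutoff x| ≤ B := by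
  have hc : Continuous fun x => x * deriv radialCutoff x :=
    continuous_id.mul (contDiff_radialCutoff.continuous_deriv le_rfl)
  obtain ⟨B, hB⟩ := (isCompact_Icc (a := (1 : ℝ)) (b := 2)).exists_bound_of_continuousOn
    hc.continuousOn
  refine ⟨B, fun x => ?_⟩
  have hB0 : 0 ≤ B := (norm_nonneg _).trans (hB 1 (by norm_num))
  by_cases h1 : x < 1
  · have : radialCutoff =ᶠ[𝓝 x] fun _ => 1 := by
      filter_upwards [gt_mem_nhds h1] with y hy using radialCutoff_of_le hy.le
    rw [this.deriv_eq]
    simpa using hB0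
  by_cases h2 : 2 < x
  · have : radialCutoff =ᶠ[𝓝 x] fun _ => 0 := by
      filter_upwards [lt_mem_nhds h2] with y hy using radialCutoff_of_ge hy.le
    rw [this.deriv_eq]
    simpa using hB0
  · exact hB x ⟨not_lt.1 h1, not_lt.1 h2⟩

lemma sum_Ico_half_pow_le (J J' : ℕ) : ∑ j ∈ Finset.Ico J J', ((1 : ℝ) / 2) ^ j ≤ 2 := by
  exact (summable_geometric_two.sum_le_tsum _ fun _ _ => by positivity).trans_eq tsum_geometric_two

/-- Borel summation at the corner: a formal series whose `j`-th term is `o(r ^ (a j - 1/2))`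
together with its derivative is the asymptotic expansion of a `C¹` function. -/
lemma exists_borel_sum {u : ℕ → ℝ → ℝ → ℂ} {a : ℕ → ℕ} (ha : Monotone a)
    (hper : ∀ j r, Function.Periodic (u j r) (2 * Real.pi))
    (hC : ∀ j, ∀ r, 0 < r → ∀ θ, ContDiffAt ℝ 1 (fun x : ℝ × ℝ => u j x.1 x.2) (r, θ))
    (hd : ∀ j, ∀ r, 0 < r → ∀ θ, DifferentiableAt ℝ (fun r => u j r θ) r)
    (hu : ∀ j, ∀ ε : ℝ, 0 < ε → ∀ᶠ r in 𝓝[>] (0 : ℝ), ∀ θ, √r * ‖u j r θ‖ ≤ ε * r ^ a j)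
    (hu' : ∀ j, ∀ ε : ℝ, 0 < ε → ∀ᶠ r in 𝓝[>] (0 : ℝ), ∀ θ,
      √r * ‖rDeriv (u j) r θ‖ ≤ ε * r ^ a j) :
    ∃ A : ℝ → ℝ → ℂ, (∀ r, Function.Periodic (A r) (2 * Real.pi)) ∧
      (∀ r, 0 < r → ∀ θ, ContDiffAt ℝ 1 (fun x : ℝ × ℝ => A x.1 x.2) (r, θ)) ∧
      ∃ C : ℝ, 0 ≤ C ∧ ∀ J : ℕ, ∀ᶠ r in 𝓝[>] (0 : ℝ), ∀ θ,
        √r * ‖A r θ - ∑ j ∈ Finset.range J, u j r θ‖ ≤ C * r ^ a J ∧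
        √r * ‖rDeriv (fun ρ t => A ρ t - ∑ j ∈ Finset.range J, u j ρ t) r θ‖ ≤ C * r ^ a J := by
  obtain ⟨B, hB⟩ := exists_abs_mul_deriv_radialCutoff_le
  have hB0 : 0 ≤ B := (abs_nonneg _).trans (hB 0)
  have hδ : ∀ j : ℕ, ∃ δ : ℝ, 0 < δ ∧ δ ≤ 1 / ((j : ℝ) + 1) ∧ ∀ r, 0 < r → r < 2 * δ → ∀ θ,
      √r * ‖u j r θ‖ ≤ (1 / 2) ^ j * r ^ a j ∧ √r * ‖rDeriv (u j) r θ‖ ≤ (1 / 2) ^ j * r ^ a j := by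
    intro j
    obtain ⟨ρ, hρ, h⟩ := mem_nhdsGT_iff_exists_Ioo_subset.1
      ((hu j ((1 / 2) ^ j) (by positivity)).and (hu' j ((1 / 2) ^ j) (by positivity)))
    have hρ : 0 < ρ := hρ
    refine ⟨min (ρ / 2) (1 / ((j : ℝ) + 1)), lt_min (by positivity) (by positivity),
      min_le_right _ _, fun r hr hr' θ => ?_⟩
    have := min_le_left (ρ / 2) (1 / ((j : ℝ) + 1))
    have hm := h (show r ∈ Set.Ioo 0 ρ from ⟨hr, by linarith⟩)
    exact ⟨hm.1 θ, hm.2 θ⟩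
  choose δ hδ0 hδ1 hδb using hδ
  set v : ℕ → ℝ → ℝ → ℂ := fun j r θ => ((radialCutoff (r / δ j) : ℝ) : ℂ) * u j r θ with hv
  have hvd : ∀ j r, 0 < r → ∀ θ, HasDerivAt (fun r => v j r θ)
      (((deriv radialCutoff (r / δ j) * (1 / δ j) : ℝ) : ℂ) * u j r θ +
        ((radialCutoff (r / δ j) : ℝ) : ℂ) * deriv (fun r => u j r θ) r) r := by
    intro j r hr θ
    have h1 : HasDerivAt (fun r => radialCutoff (r / δ j))
        (deriv radialCutoff (r / δ j) * (1 / δ j)) r :=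
      HasDerivAt.comp (h₂ := radialCutoff) r ((contDiff_radialCutoff.differentiable one_ne_zero) _).hasDerivAt
        ((hasDerivAt_id r).div_const _)
    exact h1.ofReal_comp.mul (hd j r hr θ).hasDerivAt
  have hvz : ∀ j r θ, 2 * δ j ≤ r → v j r θ = 0 := by
    intro j r θ h
    simp only [hv]
    rw [radialCutoff_of_ge ((le_div_iff₀ (hδ0 j)).2 h), Complex.ofReal_zero, zero_mul]
  have hvb : ∀ j r, 0 < r → ∀ θ, √r * ‖v j r θ‖ ≤ (B + 1) * ((1 / 2) ^ j * r ^ a j) ∧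
      √r * ‖rDeriv (v j) r θ‖ ≤ (B + 1) * ((1 / 2) ^ j * r ^ a j) := by
    intro j r hr θ
    have hpos : 0 ≤ (1 / 2 : ℝ) ^ j * r ^ a j := by positivity
    have hχ : ‖((radialCutoff (r / δ j) : ℝ) : ℂ)‖ ≤ 1 := by
      rw [Complex.norm_real]
      exact abs_radialCutoff_le _
    have e : rDeriv (v j) r θ =
        ((r / δ j * deriv radialCutoff (r / δ j) : ℝ) : ℂ) * u j r θ +
          ((radialCutoff (r / δ j) : ℝ) : ℂ) * rDeriv (u j) r θ := by
      rw [rDeriv, (hvd j r hr θ).deriv, rDeriv]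
      push_cast
      ring
    have hχ' : ‖((r / δ j * deriv radialCutoff (r / δ j) : ℝ) : ℂ)‖ ≤ B := by
      rw [Complex.norm_real]
      exact hB _
    by_cases hlt : r < 2 * δ j
    · obtain ⟨h1, h2⟩ := hδb j r hr hlt θ
      constructor
      · calc √r * ‖v j r θ‖ ≤ √r * (1 * ‖u j r θ‖) := by
              simp only [hv, norm_mul]
              gcongr
          _ ≤ (B + 1) * ((1 / 2) ^ j * r ^ a j) := by nlinarith
      · calc √r * ‖rDeriv (v j) r θ‖ ≤ √r * (B * ‖u j r θ‖ + 1 * ‖rDeriv (u j) r θ‖) := by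
              rw [e]
              gcongr
              refine (norm_add_le _ _).trans ?_
              rw [norm_mul, norm_mul]
              gcongr
          _ = B * (√r * ‖u j r θ‖) + √r * ‖rDeriv (u j) r θ‖ := by ring
          _ ≤ B * ((1 / 2) ^ j * r ^ a j) + (1 / 2) ^ j * r ^ a j := by gcongr
          _ = _ := by ring
    · have hle : 2 * δ j ≤ r := not_lt.1 hlt
      have hz : rDeriv (v j) r θ = 0 := by
        have h0 : radialCutoff (r / δ j) = 0 := radialCutoff_of_ge ((le_div_iff₀ (hδ0 j)).2 hle)
        have h0' : deriv radialCutoff (r / δ j) = 0 := by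
          refine IsLocalMin.deriv_eq_zero (Filter.Eventually.of_forall fun y => ?_)
          rw [h0]
          exact Real.smoothTransition.nonneg _
        rw [e, h0, h0']
        simp
      rw [hz, hvz j r θ hle]
      simp only [norm_zero, mul_zero]
      exact ⟨by positivity, by positivity⟩
  have hfin : ∀ r₀ : ℝ, 0 < r₀ → ∃ J₀ : ℕ, ∀ J', J₀ ≤ J' → ∀ r, r₀ < r → ∀ θ,
      ∑' j, v j r θ = ∑ j ∈ Finset.range J', v j r θ := by
    intro r₀ hr₀
    obtain ⟨J₀, hJ₀⟩ := exists_nat_gt (2 / r₀)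
    refine ⟨J₀, fun J' hJ' r hr θ => tsum_eq_sum fun j hj => hvz j r θ ?_⟩
    have hj : J' ≤ j := by simpa using hj
    have hj' : (2 : ℝ) / r₀ < (j : ℝ) + 1 := by
      have : (J₀ : ℝ) ≤ j := by exact_mod_cast hJ'.trans hj
      linarith
    have h3 : 2 * (1 / ((j : ℝ) + 1)) ≤ r₀ := by
      rw [mul_one_div, div_le_iff₀ (by positivity)]
      rw [div_lt_iff₀ hr₀] at hj'
      linarith
    linarith [hδ1 j]
  refine ⟨fun r θ => ∑' j, v j r θ, ?_, ?_, (B + 1) * 2, by positivity, ?_⟩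
  · intro r θ
    simp only [hv, hper _ r θ]
  · intro r hr θ
    obtain ⟨J₀, hJ₀⟩ := hfin (r / 2) (by positivity)
    have hc : ContDiffAt ℝ 1 (fun x : ℝ × ℝ => ∑ j ∈ Finset.range J₀, v j x.1 x.2) (r, θ) := by
      refine ContDiffAt.sum fun j _ => ContDiffAt.mul ?_ (hC j r hr θ)
      exact (Complex.ofRealCLM.contDiff.comp
        (contDiff_radialCutoff.comp (contDiff_fst.div_const _))).contDiffAt
    refine hc.congr_of_eventuallyEq ?_
    filter_upwards [continuousAt_fst.preimage_mem_nhds (lt_mem_nhds (half_lt_self hr))] with x hx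
    exact hJ₀ J₀ le_rfl _ hx _
  · intro J
    have hsmall : ∀ᶠ r in 𝓝[>] (0 : ℝ), ∀ j ∈ Finset.range J, r < δ j :=
      (Filter.eventually_all_finset _).2 fun j _ =>
        mem_nhdsWithin_of_mem_nhds (gt_mem_nhds (hδ0 j))
    filter_upwards [hsmall, Ioo_mem_nhdsGT one_pos] with r hr hr1 θ
    have hr0 : 0 < r := hr1.1
    obtain ⟨J₀, hJ₀⟩ := hfin (r / 2) (by positivity)
    set J' := max J₀ J
    have hev : ∀ᶠ ρ in 𝓝 r, ∀ t, ∑' j, v j ρ t - ∑ j ∈ Finset.range J, u j ρ t =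
        ∑ j ∈ Finset.Ico J J', v j ρ t := by
      filter_upwards [lt_mem_nhds (half_lt_self hr0),
        (Filter.eventually_all_finset (Finset.range J)).2 fun j hj => gt_mem_nhds (hr j hj)]
        with ρ hρ hρδ t
      rw [hJ₀ J' (le_max_left _ _) ρ hρ t, Finset.sum_Ico_eq_sub _ (le_max_right _ _)]
      congr 1
      refine Finset.sum_congr rfl fun j hj => ?_
      simp only [hv]
      rw [radialCutoff_of_le ((div_le_one (hδ0 j)).2 (hρδ j hj).le), Complex.ofReal_one, one_mul]
    have hbound : ∀ w : ℕ → ℂ, (∀ j, √r * ‖w j‖ ≤ (B + 1) * ((1 / 2) ^ j * r ^ a j)) →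
        √r * ‖∑ j ∈ Finset.Ico J J', w j‖ ≤ (B + 1) * 2 * r ^ a J := by
      intro w hw
      calc √r * ‖∑ j ∈ Finset.Ico J J', w j‖ ≤ √r * ∑ j ∈ Finset.Ico J J', ‖w j‖ := by
            gcongr
            exact norm_sum_le _ _
        _ ≤ ∑ j ∈ Finset.Ico J J', (B + 1) * ((1 / 2) ^ j * r ^ a J) := by
            rw [Finset.mul_sum]
            refine Finset.sum_le_sum fun j hj => (hw j).trans ?_
            have : r ^ a j ≤ r ^ a J :=
              pow_le_pow_of_le_one hr0.le hr1.2.le (ha (Finset.mem_Ico.1 hj).1)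
            gcongr
        _ = (B + 1) * (∑ j ∈ Finset.Ico J J', (1 / 2) ^ j) * r ^ a J := by
            rw [Finset.mul_sum, Finset.sum_mul]
            exact Finset.sum_congr rfl fun j _ => by ring
        _ ≤ (B + 1) * 2 * r ^ a J := by
            gcongr
            exact sum_Ico_half_pow_le J J'
    constructor
    · rw [hev.self_of_nhds θ]
      exact hbound _ fun j => (hvb j r hr0 θ).1
    · rw [rDeriv_congr (v := fun ρ t => ∑ j ∈ Finset.Ico J J', v j ρ t)
        (hev.mono fun ρ h => h θ),
        rDeriv_fun_sum fun j _ => (hvd j r hr0 θ).differentiableAt]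
      exact hbound _ fun j => (hvb j r hr0 θ).2

lemma contDiffAt_primalTerm {ω : ℝ} {k : ℕ} {Φ : ℕ → ℕ → ℝ → ℂ} (h : ∀ j n, IsAngular ω (Φ j n))
    (j : ℕ) {r : ℝ} (hr : 0 < r) (θ : ℝ) :
    ContDiffAt ℝ 1 (fun x : ℝ × ℝ => primalTerm k Φ j x.1 x.2) (r, θ) := by
  have e : (k : ℤ) + 2 * j = ((k + 2 * j : ℕ) : ℤ) := by push_cast; ring
  simp only [primalTerm, quasiHom, e, zpow_natCast]
  have h1 : ContDiffAt ℝ 1 (fun x : ℝ × ℝ => (x.1 : ℂ)) (r, θ) :=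
    (Complex.ofRealCLM.contDiff.comp contDiff_fst).contDiffAt
  have h2 : ContDiffAt ℝ 1 (fun x : ℝ × ℝ => ((Real.log x.1 : ℝ) : ℂ)) (r, θ) :=
    Complex.ofRealCLM.contDiff.contDiffAt.comp _
      ((Real.contDiffAt_log.2 hr.ne').comp (r, θ) contDiffAt_fst)
  refine (h1.pow _).mul (ContDiffAt.sum fun n _ => (h2.pow n).mul ?_)
  exact ((h j n).contDiff_one.comp contDiff_snd).contDiffAt

/-- Every primal singular function is the corner expansion of an actual function. -/
lemma exists_hasCornerExpansion_single {ω : ℝ} (ζ : ℝ)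
    {Φ : ℕ → Fin 2 → ℕ → ℕ → ℝ → ℂ} (hΦ : ∀ k p, IsPrimalSingularity ω k p (Φ k p))
    (k : ℕ) (p : Fin 2) :
    ∃ A, HasCornerExpansion ζ Φ A fun k' p' => if k' = k ∧ p' = p then 1 else 0 := by
  set z : ℂ := Complex.I * (ζ : ℂ) ^ 2
  have h := (hΦ k p).isShadowFamily
  have hz : ∀ j n, j < n → Φ k p j n = 0 := (hΦ k p).eq_zero_of_lt
  have hreg : ∀ j r, 0 < r → IsRadiallyRegular r (primalTerm k (Φ k p) j) := fun j r hr =>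
    isRadiallyRegular_shadowTerm h j hr
  have hmul : ∀ (c : ℂ) (b : ℕ) (q : ℝ → ℝ → ℂ), (∀ ε : ℝ, 0 < ε → ∀ᶠ r in 𝓝[>] (0 : ℝ), ∀ θ,
      √r * ‖q r θ‖ ≤ ε * r ^ b) → ∀ ε : ℝ, 0 < ε → ∀ᶠ r in 𝓝[>] (0 : ℝ), ∀ θ,
      √r * ‖c * q r θ‖ ≤ ε * r ^ b := by
    intro c b q hq ε hε
    have hc : 0 < ‖c‖ + 1 := by positivity
    filter_upwards [hq (ε / (‖c‖ + 1)) (by positivity)] with r hr θ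
    calc √r * ‖c * q r θ‖ = ‖c‖ * (√r * ‖q r θ‖) := by rw [norm_mul]; ring
      _ ≤ (‖c‖ + 1) * (√r * ‖q r θ‖) := by gcongr; linarith
      _ ≤ (‖c‖ + 1) * (ε / (‖c‖ + 1) * r ^ b) :=
          mul_le_mul_of_nonneg_left (hr θ) hc.le
      _ = ε * r ^ b := by field_simp
  have hq : ∀ (j : ℕ) (Φ' : ℕ → ℝ → ℂ), (∀ n, Continuous (Φ' n)) →
      (∀ n, Function.Periodic (Φ' n) (2 * Real.pi)) → ∀ ε : ℝ, 0 < ε →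
      ∀ᶠ r in 𝓝[>] (0 : ℝ), ∀ θ,
        √r * ‖quasiHom ((k : ℤ) + 2 * j) j Φ' r θ‖ ≤ ε * r ^ (k + 2 * j) := by
    intro j Φ' hc hp ε hε
    have e : (k : ℤ) + 2 * j = ((k + 2 * j : ℕ) : ℤ) := by push_cast; ring
    refine (eventually_sqrt_mul_norm_quasiHom_le (a := (k : ℤ) + 2 * j) (d := j) hc hp hε).mono
      fun r hr θ => (hr θ).trans_eq ?_
    rw [e, zpow_natCast]
  obtain ⟨A, hAp, hAc, C, hC0, hA⟩ := exists_borel_sum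
    (u := fun j r θ => z ^ j * primalTerm k (Φ k p) j r θ) (a := fun j => k + 2 * j)
    (fun i j hij => by simpa using hij)
    (fun j r θ => by
      simp only [primalTerm, periodic_quasiHom (fun n => (h.angular j n).periodic) r θ])
    (fun j r hr θ => contDiffAt_const.mul (contDiffAt_primalTerm h.angular j hr θ))
    (fun j r hr θ => ((hreg j r hr).differentiableAt θ).const_mul _)
    (fun j => hmul _ _ _ (hq j _ (h.continuous j) fun n => (h.angular j n).periodic))
    (fun j ε hε => by
      filter_upwards [self_mem_nhdsWithin, hmul (z ^ j) _ _ (hq j _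
        (continuous_eulerCoeff (a := (k : ℤ) + 2 * j) (h.continuous j))
        (IsAngular.periodic_eulerCoeff (h.angular j))) ε hε] with r hr hb θ
      have e : rDeriv (primalTerm k (Φ k p) j) r θ = _ := rDeriv_quasiHom (hz j) hr θ
      rw [rDeriv_const_mul _ ((hreg j r hr).differentiableAt θ), e]
      exact hb θ)
  have hpart : ∀ N, ∃ J, N + 1 ≤ k + 2 * J ∧ cornerPartialSum ζ Φ
      (fun k' p' => if k' = k ∧ p' = p then 1 else 0) N =
      fun r θ => ∑ j ∈ Finset.range J, z ^ j * primalTerm k (Φ k p) j r θ := by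
    intro N
    by_cases hk : k ≤ N
    · refine ⟨(N - k) / 2 + 1, by omega, ?_⟩
      funext r θ
      rw [cornerPartialSum, Finset.sum_eq_single k, Finset.sum_eq_single p]
      · simp [primalTrunc, z]
      · intro p' _ hp'
        simp [hp']
      · simp
      · intro k' _ hk'
        simp [hk']
      · intro hn
        exact absurd (Finset.mem_range.2 (by omega)) hn
    · refine ⟨0, by omega, ?_⟩
      funext r θ
      rw [cornerPartialSum, Finset.range_zero, Finset.sum_empty]
      refine Finset.sum_eq_zero fun k' hk' => ?_
      have := Finset.mem_range.1 hk'
      have hne : k' ≠ k := by omega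
      simp [hne]
  refine ⟨A, hAp, ⟨1, one_pos, fun x hx => (hAc x.1 hx.1.1 x.2).contDiffWithinAt⟩, fun N ε hε => ?_⟩
  obtain ⟨J, hJ, hJe⟩ := hpart N
  have hlim : Tendsto (fun r : ℝ => C * √r) (𝓝[>] 0) (𝓝 0) := by
    have : Tendsto (fun r : ℝ => C * √r) (𝓝 0) (𝓝 (C * √0)) :=
      (continuous_const.mul Real.continuous_sqrt).tendsto 0
    rw [Real.sqrt_zero, mul_zero] at this
    exact this.mono_left nhdsWithin_le_nhds
  rw [hJe]
  filter_upwards [hA J, hlim.eventually_le_const hε, Ioo_mem_nhdsGT one_pos] with r hr hrε hr1 θ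
  have hr0 : 0 < r := hr1.1
  have hs : 0 < √r := Real.sqrt_pos.2 hr0
  have hb : ∀ x : ℝ, √r * x ≤ C * r ^ (k + 2 * J) → x ≤ ε * r ^ N := by
    intro x hx
    refine le_of_mul_le_mul_left (hx.trans ?_) hs
    calc C * r ^ (k + 2 * J) ≤ C * r ^ (N + 1) := by
          gcongr ?_ * ?_
          exact pow_le_pow_of_le_one hr0.le hr1.2.le hJ
      _ = √r * (C * √r) * r ^ N := by
          rw [pow_succ]
          nth_rewrite 2 [← Real.mul_self_sqrt hr0.le]
          ring
      _ ≤ √r * ε * r ^ N := by gcongr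
      _ = √r * (ε * r ^ N) := by ring
  exact ⟨hb _ (hr θ).1, hb _ (hr θ).2⟩

end

theorem propositionP
    (ω : ℝ) (hω : ω ∈ Set.Ioo 0 (2 * Real.pi)) (ζ : ℝ) (hζ : 0 < ζ)
    (Φ : ℕ → Fin 2 → ℕ → ℕ → ℝ → ℂ) (hΦ : ∀ k p, IsPrimalSingularity ω k p (Φ k p))
    (k : ℕ) (hk : 2 ≤ k) (p : Fin 2)
    (Ψ : ℕ → ℕ → ℝ → ℂ) (hΨ : IsDualSingularity ω k p Ψ)
    (m : ℕ) (hm : k < 2 * m + 2) :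
    (∀ c : ℕ → ℂ, IsCouplingFamily ζ Φ k p Ψ m c ↔
      ∀ l ∈ Finset.Icc 1 (k / 2), c l = angularCoupling ζ k l (Φ (k - 2 * l) p) Ψ) ∧
    (∀ l ∈ Finset.Icc 1 (k / 2), ∀ m' : ℕ, m ≤ m' →
      Tendsto (fun R : ℝ => dualForm R (dualTrunc ζ k Ψ m)
          (primalTrunc ζ (k - 2 * l) (Φ (k - 2 * l) p) m'))
        (𝓝[>] 0) (𝓝 (angularCoupling ζ k l (Φ (k - 2 * l) p) Ψ))) := by
  have hk0 : k ≠ 0 := by omega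
  have hfam := isCouplingFamily_angularCoupling hζ hΦ hk0 hΨ hm
  refine ⟨fun c => ⟨fun hc l hl => ?_, fun hc => ?_⟩, fun l hl m' hm' => ?_⟩
  · have hl' := Finset.mem_Icc.1 hl
    obtain ⟨A, Λ, hΛ, hA⟩ : ∃ A Λ, (∀ i, Λ i p = if i = k - 2 * l then 1 else 0) ∧
        HasCornerExpansion ζ Φ A Λ := by
      obtain ⟨A, hA⟩ := exists_hasCornerExpansion_single ζ hΦ (k - 2 * l) p
      exact ⟨A, _, fun i => by simp, hA⟩
    have hsingle : ∀ c' : ℕ → ℂ, ∑ i ∈ Finset.Icc 1 (k / 2),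
        c' i * Λ (k - 2 * i) p = c' l := by
      intro c'
      rw [Finset.sum_eq_single l]
      · rw [hΛ, if_pos rfl, mul_one]
      · intro i hi hne
        have := Finset.mem_Icc.1 hi
        rw [hΛ, if_neg (by omega), mul_zero]
      · intro h
        exact absurd hl h
    have h1 := (hc A _ hA).trans_tendsto (tendsto_couplingRemainder hm)
    have h2 := (hfam A _ hA).trans_tendsto (tendsto_couplingRemainder hm)
    have h3 := h2.sub h1
    simp only [hsingle, sub_zero] at h3
    have h4 := tendsto_nhds_unique
      (tendsto_const_nhds.congr fun R => by ring : Tendsto (fun R => _ - _) (𝓝[>] (0 : ℝ))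
        (𝓝 (c l - angularCoupling ζ k l (Φ (k - 2 * l) p) Ψ))) h3
    exact sub_eq_zero.1 h4
  · intro A Λ hA
    rw [Finset.sum_congr rfl fun l hl => by rw [hc l hl]]
    exact hfam A Λ hA
  · have := (Finset.mem_Icc.1 hl).2
    exact tendsto_dualForm_dualTrunc_primalTrunc (hΨ.isShadowFamily hk0) (by omega)
      (hΦ (k - 2 * l) p).isShadowFamily hm hm'
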